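/- Let $\mathbb F_q$ be a finite field of odd characteristic and let $C: y^2=f(x)$ be an elliptic or hyperelliptic curve of genus $g\ge 1$ over $\mathbb F_q$, where $f\in\mathbb F_q[x]$ is monic of degree $2g+1$ without multiple zeros; let $\mathcal O$ be its point at infinity. Let $w(X,Y)=(X,-Y)$ be the involution and $\varphi(X,Y)=(X^q,Y^q)$ the Frobenius, both fixing $\mathcal O$ and extended to the divisors of $C$ (over $\overline{\mathbb F}_q$). Let $n$ be a prime number. A divisor $D$ is $\mathbb F_{q^m}$-rational if $\varphi^m(D)=D$, and we put $\mathrm{Tr}(D)=D+\varphi(D)+\dots+\varphi^{n-1}(D)$. For $u\in\mathbb F_{q^n}[x]$ put $N(u)=u\,u^{\varphi}\cdots u^{\varphi^{n-1}}$, where $\varphi$ acts on the coefficients. Let $\mathrm{Pic}^0$ be the group of divisors of degree $0$ modulo principal divisors, let $\mathrm{Pic}^0(\mathbb F_{q^m})$ be its subgroup of classes of $\mathbb F_{q^m}$-rational divisors, let $\mathrm{Pic}^0[2](\mathbb F_q)$ be the $2$-torsion subgroup of $\mathrm{Pic}^0(\mathbb F_q)$, and let $T_n$ be the set of the classes $[D]\in\mathrm{Pic}^0(\mathbb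 F_{q^n})$, with $D$ an $\mathbb F_{q^n}$-rational divisor of degree $0$, such that $\mathrm{Tr}(D)$ is principal. For divisors $D,D'$ of degree $0$ write $D\le D'$ if the coefficient of $D$ at each affine point is at most that of $D'$. A divisor $D=P_1+\dots+P_r-r\mathcal O$ with affine points $P_i=(X_i,Y_i)$ is reduced if $P_i\ne w(P_j)$ for $i\ne j$ and $r\le g$; its Mumford representation is $[u,v]$ with $u=\prod_i(x-X_i)$, $\deg v<\deg u$, $v(X_i)=Y_i$ and $u\mid v^2-f$. An $\mathbb F_{q^n}$-rational reduced divisor is prime if its $u$ is irreducible in $\mathbb F_{q^n}[x]$. **Theorem.** Let $D$ be a reduced divisor with $[D]\in T_n$, let $h_D=h_{D,1}(x)+y\,h_{D,2}(x)$ with $h_{D,1},h_{D,2}\in\mathbb F_q[x]$ be such that $\mathrm{div}(h_D)=\mathrm{Tr}(D)$, and write $D=D_1+\dots+D_t$ with reduced prime $\mathbb F_{q^n}$-rational divisors $D_i$ with Mumford representations $[u_i,v_i]$. Then for every $i\in\{1,\dots,t\}$: (i) $u_i\mid h_{D,2}$ if and only if $w(D_i)=\varphi^j(D_k)$ for some $j\in\{0,\dots,n-1\}$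 and $k\in\{1,\dots,t\}$ with $(j,k)\ne(0,i)$. (The condition $(j,k)\neq(0,i)$ is automatic if $D_i\ne w(D_i)$.) (ii) If $n\ne2$, then $w(D_i)=\varphi^j(D_i)$ for some $j\in\{1,\dots,n-1\}$ if and only if $[D_i]\in\mathrm{Pic}^0[2](\mathbb F_q)$. (iii) If $n\ne 2$ and $D_i\ne w(D_i)$, then for every integer $s\ge0$ the following are equivalent: (a) there are integers $\ell,m\ge0$ with $\min\{\ell,m\}=s$ and an $\mathbb F_{q^n}$-rational divisor $G$ of degree $0$ with poles only at $\mathcal O$ such that $\mathrm{Tr}(D)=m\,\mathrm{Tr}(D_i)+\ell\,\mathrm{Tr}(w(D_i))+\mathrm{Tr}(G)$, $\mathrm{Tr}(D_i)\not\le\mathrm{Tr}(G)$ and $\mathrm{Tr}(w(D_i))\not\le\mathrm{Tr}(G)$; (b) $N(u_i)^s$ exactly divides $h_D$, that is, $N(u_i)^s\mid h_D$ and $N(u_i)^{s+1}\nmid h_D$ in the coordinate ring $\mathbb F_{q^n}[x,y]/(y^2-f)$. -/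

import Mathlib

open Polynomial

noncomputable section

/-- An elliptic (`g = 1`) or hyperelliptic curve `y ^ 2 = f(x)` of genus `g ≥ 1` over a field `F` of
characteristic different from `2`, with `f` monic of degree `2 g + 1` without multiple zeros. -/
structure HECurve (F : Type*) [Field F] where
  f : F[X]
  g : ℕ
  g_pos : 1 ≤ g
  monic : f.Monic
  natDegree_eq : f.natDegree = 2 * g + 1
  separable : f.Separable
  two_ne_zero : (2 : F) ≠ 0

namespace HECurve

/-- An affine point of the curve, with coordinates in an extension `E` of `F`. -/
@[ext]
structure AffinePoint {F : Type*} [Field F] (C : HECurve F) (E : Type*) [Field E] [Algebra F E] where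
  x : E
  y : E
  equation : y ^ 2 = aeval x C.f

/-- The points of the projective curve: `none` is the point at infinity `O`. -/
abbrev Point {F : Type*} [Field F] (C : HECurve F) (E : Type*) [Field E] [Algebra F E] : Type _ :=
  Option (C.AffinePoint E)

/-- The hyperelliptic involution `(X, Y) ↦ (X, -Y)` on affine points. -/
def AffinePoint.invol {F : Type*} [Field F] {C : HECurve F} {E : Type*} [Field E] [Algebra F E]
    (P : C.AffinePoint E) : C.AffinePoint E where
  x := P.x
  y := -P.y
  equation := by rw [neg_sq, P.equation]

/-- The `q`-Frobenius `(X, Y) ↦ (X ^ q, Y ^ q)` on affine points, where `q` is the number of elements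
of the base field `F`. -/
def AffinePoint.frob {F : Type*} [Field F] [Fintype F] {C : HECurve F} {E : Type*} [Field E]
    [Algebra F E] (P : C.AffinePoint E) : C.AffinePoint E where
  x := P.x ^ Fintype.card F
  y := P.y ^ Fintype.card F
  equation := by
    have h := aeval_algHom_apply (FiniteField.frobeniusAlgHom F E) P.x C.f
    rw [← P.equation] at h
    simp only [FiniteField.coe_frobeniusAlgHom] at h
    rw [h]
    ring

/-- The group of divisors on the curve. -/
abbrev Divisor {F : Type*} [Field F] (C : HECurve F) (E : Type*) [Field E] [Algebra F E] : Type _ :=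
  C.Point E →₀ ℤ

/-- The involution `w` on divisors (it fixes `O`). -/
def w {F : Type*} [Field F] {C : HECurve F} {E : Type*} [Field E] [Algebra F E] :
    C.Divisor E →+ C.Divisor E :=
  Finsupp.mapDomain.addMonoidHom (Option.map AffinePoint.invol)

/-- The Frobenius `φ` on divisors (it fixes `O`). -/
def φ {F : Type*} [Field F] [Fintype F] {C : HECurve F} {E : Type*} [Field E] [Algebra F E] :
    AddMonoid.End (C.Divisor E) :=
  Finsupp.mapDomain.addMonoidHom (Option.map AffinePoint.frob)

/-- The trace `Tr(D) = D + φ(D) + ⋯ + φ ^ (n - 1) (D)`. -/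
def Tr {F : Type*} [Field F] [Fintype F] {C : HECurve F} {E : Type*} [Field E] [Algebra F E]
    (n : ℕ) : C.Divisor E →+ C.Divisor E where
  toFun D := ∑ j ∈ Finset.range n, (φ ^ j : AddMonoid.End (C.Divisor E)) D
  map_zero' := by simp
  map_add' D₁ D₂ := by simp [Finset.sum_add_distrib]

/-- The divisors rational over the extension of degree `m` of `F`: those with `φ ^ m (D) = D`. -/
def rationalDiv {F : Type*} [Field F] [Fintype F] (C : HECurve F) (E : Type*) [Field E]
    [Algebra F E] (m : ℕ) : AddSubgroup (C.Divisor E) :=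
  AddMonoidHom.eqLocus (φ ^ m : AddMonoid.End (C.Divisor E)) (AddMonoidHom.id (C.Divisor E))

/-- The divisors of degree zero. -/
def Div0 {F : Type*} [Field F] (C : HECurve F) (E : Type*) [Field E] [Algebra F E] :
    AddSubgroup (C.Divisor E) :=
  AddMonoidHom.ker (Finsupp.degree : C.Divisor E →+ ℤ)

/-- The relation `D₁ ≤ D₂`: comparison of the coefficients at all affine points. -/
def AffineLE {F : Type*} [Field F] {C : HECurve F} {E : Type*} [Field E] [Algebra F E]
    (D₁ D₂ : C.Divisor E) : Prop :=
  ∀ P : C.AffinePoint E, D₁ (some P) ≤ D₂ (some P)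

/-- The coordinate ring `E[x, y] / (y ^ 2 - f(x))` of the affine curve over `E`. -/
abbrev CoordRing {F : Type*} [Field F] (C : HECurve F) (E : Type*) [Field E] [Algebra F E] : Type _ :=
  AdjoinRoot (X ^ 2 - Polynomial.C (C.f.map (algebraMap F E)) : E[X][X])

/-- The polynomial function `p(x) + y q(x)` on the curve. -/
def func {F : Type*} [Field F] (C : HECurve F) {E : Type*} [Field E] [Algebra F E] (p q : E[X]) :
    C.CoordRing E :=
  AdjoinRoot.of _ p + AdjoinRoot.root _ * AdjoinRoot.of _ q

/-- The maximal ideal `(x - X, y - Y)` of the affine point `(X, Y)` in the coordinate ring. -/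
def AffinePoint.maxIdeal {F : Type*} [Field F] {C : HECurve F} {E : Type*} [Field E] [Algebra F E]
    (P : C.AffinePoint E) : Ideal (C.CoordRing E) :=
  Ideal.span {C.func (X - Polynomial.C P.x) 0, C.func (-Polynomial.C P.y) 1}

/-- The pole order at `O` of `p(x) + y q(x)`: the function `x` has a pole of order `2` and `y` one of
order `2 g + 1`, so the two summands have pole orders of different parity and no cancellation occurs. -/
def poleOrder {F : Type*} [Field F] (C : HECurve F) {E : Type*} [Field E] [Algebra F E]
    (p q : E[X]) : ℕ :=
  open Classical in
  max (2 * p.natDegree) (if q = 0 then 0 else 2 * q.natDegree + (2 * C.g + 1))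

/-- `C.HasDivisor p q D` says that the function `p(x) + y q(x)` is not zero and has divisor `D`.
The order of vanishing at an affine point `P`, where the curve is smooth, is the largest `k` such that
the function lies in the `k`-th power of the maximal ideal of `P`. -/
def HasDivisor {F : Type*} [Field F] (C : HECurve F) {E : Type*} [Field E] [Algebra F E]
    (p q : E[X]) (D : C.Divisor E) : Prop :=
  (p ≠ 0 ∨ q ≠ 0) ∧
  (∀ P : C.AffinePoint E, ∃ k : ℕ, D (some P) = k ∧
    C.func p q ∈ P.maxIdeal ^ k ∧ C.func p q ∉ P.maxIdeal ^ (k + 1)) ∧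
  D none = -(C.poleOrder p q : ℤ)

/-- The group of principal divisors. Every rational function on the curve is a quotient of two
polynomial functions, so this is the group generated by the divisors of polynomial functions. -/
def principal {F : Type*} [Field F] (C : HECurve F) (E : Type*) [Field E] [Algebra F E] :
    AddSubgroup (C.Divisor E) :=
  AddSubgroup.closure {D | ∃ p q : E[X], C.HasDivisor p q D}

/-- The Picard group: divisors of degree zero modulo principal divisors. -/
abbrev Pic0 {F : Type*} [Field F] (C : HECurve F) (E : Type*) [Field E] [Algebra F E] : Type _ :=
  C.Div0 E ⧸ (C.principal E).addSubgroupOf (C.Div0 E)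

/-- The class `[D]` of a divisor of degree zero. -/
def cls {F : Type*} [Field F] {C : HECurve F} {E : Type*} [Field E] [Algebra F E] :
    C.Div0 E →+ C.Pic0 E :=
  QuotientAddGroup.mk' _

/-- The subgroup of the Picard group of the classes of divisors that are rational over the extension
of degree `m` of `F`. -/
def picRational {F : Type*} [Field F] [Fintype F] (C : HECurve F) (E : Type*) [Field E]
    [Algebra F E] (m : ℕ) : AddSubgroup (C.Pic0 E) :=
  ((C.rationalDiv E m).addSubgroupOf (C.Div0 E)).map cls

/-- The trace zero subgroup `T_n`: the classes of those divisors `D` of degree zero, rational over the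
extension of degree `n` of `F`, for which `Tr(D)` is principal. -/
def traceZero {F : Type*} [Field F] [Fintype F] (C : HECurve F) (E : Type*) [Field E]
    [Algebra F E] (n : ℕ) : AddSubgroup (C.Pic0 E) :=
  ((C.rationalDiv E n ⊓ (C.principal E).comap (Tr n)).addSubgroupOf (C.Div0 E)).map cls

/-- The divisor `P₁ + ⋯ + P_r - r O`. -/
def ofPoints {F : Type*} [Field F] {C : HECurve F} {E : Type*} [Field E] [Algebra F E] {r : ℕ}
    (P : Fin r → C.AffinePoint E) : C.Divisor E :=
  ∑ i, Finsupp.single (some (P i)) 1 - Finsupp.single none (r : ℤ)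

/-- `D = P₁ + ⋯ + P_r - r O` with `r ≤ g`, all `P_i` affine, and `P_i ≠ w(P_j)` for `i ≠ j`. -/
def IsReduced {F : Type*} [Field F] {C : HECurve F} {E : Type*} [Field E] [Algebra F E]
    (D : C.Divisor E) : Prop :=
  ∃ (r : ℕ) (P : Fin r → C.AffinePoint E), r ≤ C.g ∧ D = ofPoints P ∧
    ∀ i j, i ≠ j → P i ≠ (P j).invol

/-- `[u, v]`, with coefficients in the field `L`, is the Mumford representation of the semi-reduced
divisor `D = P₁ + ⋯ + P_r - r O`: `u = ∏ (x - X_i)`, `deg v < deg u`, `v(X_i) = Y_i`, and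
`u ∣ v ^ 2 - f`. -/
def IsMumford {F : Type*} [Field F] {C : HECurve F} {E : Type*} [Field E] [Algebra F E]
    {L : Type*} [Field L] [Algebra F L] [Algebra L E] (D : C.Divisor E) (u v : L[X]) : Prop :=
  ∃ (r : ℕ) (P : Fin r → C.AffinePoint E), D = ofPoints P ∧
    (∀ i j, i ≠ j → P i ≠ (P j).invol) ∧
    u.map (algebraMap L E) = ∏ i, (X - Polynomial.C (P i).x) ∧
    v.degree < u.degree ∧
    (∀ i, aeval (P i).x v = (P i).y) ∧
    u ∣ v ^ 2 - C.f.map (algebraMap F L)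

/-- `D` is a reduced prime divisor defined over the extension `L` of degree `n` of `F`, with Mumford
representation `[u, v]`. -/
def IsPrimeDivisor {F : Type*} [Field F] [Fintype F] {C : HECurve F} {E : Type*} [Field E]
    [Algebra F E] {L : Type*} [Field L] [Algebra F L] [Algebra L E] (n : ℕ) (D : C.Divisor E)
    (u v : L[X]) : Prop :=
  IsReduced D ∧ D ∈ C.rationalDiv E n ∧ IsMumford D u v ∧ Irreducible u

end HECurve

/-- The norm `N(u) = u u^φ ⋯ u^(φ^(n-1))`, where `φ : a ↦ a ^ q` acts on the coefficients. -/
def polyNorm (F : Type*) [Field F] [Fintype F] {L : Type*} [Field L] [Algebra F L] (n : ℕ)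
    (u : L[X]) : L[X] :=
  ∏ j ∈ Finset.range n, u.map (FiniteField.frobeniusAlgHom F L ^ j : L →ₐ[F] L).toRingHom

end

/-! Everything is read off from orders of vanishing at affine points over the algebraic closure.
Each maximal ideal of the coordinate ring is locally principal, so orders are additive, and a
polynomial in `x` divides `p + y q` exactly when its order is nowhere larger
(`func_dvd_iff_ord_le`). A prime divisor is cut out by an irreducible `u` on the graph of `v`: two
of them sharing a point coincide (`IsGraphDivisor.eq_of_apply_ne_zero`), and `u` has affine divisor
`D + w(D)`. Hence `N(u)` has affine divisor `Tr(D) + Tr(w(D))`.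

(i) Take a point `P` of `D_i`. Since `h_D` vanishes at `P`, the condition `u_i ∣ h_{D,2}` means that
both components vanish at `x(P)`, that is, `h_D` also vanishes at `w(P)`, or doubly at `P` if `P =
w(P)` (`AffinePoint.ord_X_sub_C_le_iff`). So some further summand `φ^j(D_k)` of `Tr(D)` contains
`w(P)`, and it must equal `w(D_i)`.

(ii) If `w(D) = φ^j(D)`, then `φ^(2j)` fixes `D`; as `2j` is prime to `n`, so does `φ`, hence also
`w`, and `D + w(D) ∼ 0` becomes `2D ∼ 0`. Conversely, a reduced divisor is determined by its class
(`IsReduced.eq_of_sub_mem_principal`), so invariance of the class is invariance of the divisor.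

(iii) For odd prime `n` and `D_i ≠ w(D_i)`, the traces of `D_i` and `w(D_i)` have disjoint affine
supports. Any decomposition with multiplicities `m`, `l` therefore makes `min(l, m)` the exact
exponent of `N(u_i)` (`exact_of_decomposition`). One exists, by collecting the `D_k` conjugate to
`D_i` or to `w(D_i)` (`exists_decomposition`), and the exact exponent is unique. -/

open Polynomial

noncomputable section

namespace HECurve

/-! ### The coordinate ring as a free module with basis `1, y` over `E[x]`. -/

section CoordinateRing

variable {F : Type*} [Field F] (C : HECurve F) {E : Type*} [Field E] [Algebra F E]

/-- The polynomial `f` with coefficients in the extension `E`. -/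
abbrev fE (E : Type*) [Field E] [Algebra F E] : E[X] := C.f.map (algebraMap F E)

lemma natDegree_fE : (C.fE E).natDegree = 2 * C.g + 1 := by
  rw [natDegree_map, C.natDegree_eq]

lemma monic_fE : (C.fE E).Monic := C.monic.map _

lemma eval_fE (x : E) : (C.fE E).eval x = aeval x C.f := by
  rw [eval_map_algebraMap]

lemma two_ne_zero_extension (C : HECurve F) (E : Type*) [Field E] [Algebra F E] : (2 : E) ≠ 0 := by
  simpa only [map_ofNat, map_zero] using (algebraMap F E).injective.ne C.two_ne_zero

lemma monic_poly : (X ^ 2 - Polynomial.C (C.fE E) : E[X][X]).Monic :=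
  monic_X_pow_sub_C _ _root_.two_ne_zero

lemma natDegree_poly : (X ^ 2 - Polynomial.C (C.fE E) : E[X][X]).natDegree = 2 :=
  natDegree_X_pow_sub_C

lemma func_def (p q : E[X]) : C.func p q =
    AdjoinRoot.mk _ (Polynomial.C p + X * Polynomial.C q) := by
  simp only [func, map_add, map_mul, AdjoinRoot.mk_C, AdjoinRoot.mk_X]

lemma root_sq : (AdjoinRoot.root (X ^ 2 - Polynomial.C (C.fE E) : E[X][X])) ^ 2 =
    AdjoinRoot.of _ (C.fE E) := by
  have := AdjoinRoot.eval₂_root (X ^ 2 - Polynomial.C (C.fE E) : E[X][X])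
  simpa [sub_eq_zero] using this

lemma func_mul (p q p' q' : E[X]) : C.func p q * C.func p' q' =
    C.func (p * p' + C.fE E * (q * q')) (p * q' + q * p') := by
  simp only [func, map_add, map_mul]
  linear_combination (AdjoinRoot.of _ q * AdjoinRoot.of _ q') * C.root_sq (E := E)

lemma func_add (p q p' q' : E[X]) : C.func p q + C.func p' q' = C.func (p + p') (q + q') := by
  simp only [func, map_add]; ring

lemma func_mul_left (r p q : E[X]) : C.func r 0 * C.func p q = C.func (r * p) (r * q) := by
  rw [func_mul]; simp

lemma func_zero : C.func (0 : E[X]) 0 = 0 := by simp [func]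

lemma func_one : C.func (1 : E[X]) 0 = 1 := by simp [func]

lemma func_eq_zero {p q : E[X]} : C.func p q = 0 ↔ p = 0 ∧ q = 0 := by
  constructor
  · intro h
    rw [func_def, AdjoinRoot.mk_eq_zero] at h
    have h0 : (Polynomial.C p + X * Polynomial.C q : E[X][X]) = 0 := by
      by_contra hne
      refine C.monic_poly.not_dvd_of_degree_lt hne ?_ h
      rw [degree_eq_natDegree C.monic_poly.ne_zero, natDegree_poly, add_comm, X_mul_C]
      exact lt_of_le_of_lt degree_linear_le (by norm_num)
    have h1 := congrArg (fun r => coeff r 0) h0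
    have h2 := congrArg (fun r => coeff r 1) h0
    simp [coeff_C] at h1 h2
    exact ⟨h1, h2⟩
  · rintro ⟨rfl, rfl⟩; exact C.func_zero

lemma func_inj {p q p' q' : E[X]} : C.func p q = C.func p' q' ↔ p = p' ∧ q = q' := by
  rw [← sub_eq_zero]
  have : C.func p q - C.func p' q' = C.func (p - p') (q - q') := by
    simp only [func, map_sub]; ring
  rw [this, func_eq_zero, sub_eq_zero, sub_eq_zero]

lemma exists_eq_func (a : C.CoordRing E) : ∃ p q : E[X], a = C.func p q := by
  obtain ⟨a, rfl⟩ := AdjoinRoot.mk_surjective a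
  have h1 : AdjoinRoot.mk (X ^ 2 - Polynomial.C (C.fE E)) a =
      AdjoinRoot.mk _ (a %ₘ (X ^ 2 - Polynomial.C (C.fE E))) := by
    rw [AdjoinRoot.mk_eq_mk]
    refine ⟨a /ₘ (X ^ 2 - Polynomial.C (C.fE E)), ?_⟩
    linear_combination -modByMonic_add_div a (X ^ 2 - Polynomial.C (C.fE E))
  have h2 : (a %ₘ (X ^ 2 - Polynomial.C (C.fE E))).natDegree ≤ 1 := by
    have := natDegree_modByMonic_lt a C.monic_poly (fun h => by
      have := C.natDegree_poly (E := E); rw [h] at this; simp at this)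
    rw [C.natDegree_poly] at this; omega
  obtain ⟨q, p, h⟩ := exists_eq_X_add_C_of_natDegree_le_one h2
  exact ⟨p, q, by rw [h1, h, func_def]; congr 1; ring⟩

/-- Multiplication by `r(x)` acts coordinatewise in the basis `1, y`. -/
lemma func_dvd_iff {r p q : E[X]} : C.func r 0 ∣ C.func p q ↔ r ∣ p ∧ r ∣ q := by
  constructor
  · rintro ⟨a, ha⟩
    obtain ⟨p', q', rfl⟩ := C.exists_eq_func a
    rw [func_mul_left, func_inj] at ha
    exact ⟨⟨_, ha.1⟩, ⟨_, ha.2⟩⟩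
  · rintro ⟨⟨p', rfl⟩, ⟨q', rfl⟩⟩
    exact ⟨C.func p' q', by rw [func_mul_left]⟩

lemma func_pow (r : E[X]) (s : ℕ) : C.func (r ^ s) 0 = C.func r 0 ^ s := by
  induction s with
  | zero => simp [func_one]
  | succ s ih => rw [pow_succ, pow_succ, ← ih, func_mul_left]; simp

/-- A factorization would be `(y - a)(y + a)` with `f = a ^ 2`, but `f` has odd degree. -/
lemma irreducible_poly : Irreducible (X ^ 2 - Polynomial.C (C.fE E) : E[X][X]) := by
  by_contra h
  obtain ⟨a, b, h0, h1⟩ :=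
    (C.monic_poly.not_irreducible_iff_exists_add_mul_eq_coeff C.natDegree_poly).mp h
  simp [coeff_X_pow] at h0 h1
  have hb : b = -a := by linear_combination -h1
  have hf : C.fE E = a * a := by rw [hb] at h0; linear_combination -h0
  have := C.natDegree_fE (E := E)
  rw [hf, ← pow_two, natDegree_pow] at this
  omega

instance : IsDomain (C.CoordRing E) := AdjoinRoot.isDomain_of_prime C.irreducible_poly.prime

variable {C}

/-! ### Maximal ideals of affine points and local generators. -/

namespace AffinePoint

/-- Evaluation of functions at an affine point. -/
def evalHom (P : C.AffinePoint E) : C.CoordRing E →+* E :=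
  AdjoinRoot.lift (evalRingHom P.x) P.y (by
    simp [P.equation])

lemma evalHom_func (P : C.AffinePoint E) (p q : E[X]) :
    P.evalHom (C.func p q) = p.eval P.x + P.y * q.eval P.x := by
  simp [evalHom, func]

lemma mem_maxIdeal {P : C.AffinePoint E} {p q : E[X]} :
    C.func p q ∈ P.maxIdeal ↔ p.eval P.x + P.y * q.eval P.x = 0 := by
  constructor
  · intro h
    have hle : P.maxIdeal ≤ RingHom.ker P.evalHom := by
      rw [maxIdeal, Ideal.span_le]
      rintro _ (rfl | rfl) <;> simp [evalHom_func, RingHom.mem_ker]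
    have := hle h
    rwa [RingHom.mem_ker, evalHom_func] at this
  · intro h
    have hx : C.func (X - Polynomial.C P.x) 0 ∈ P.maxIdeal := Ideal.subset_span (by simp)
    have hy : C.func (-Polynomial.C P.y) 1 ∈ P.maxIdeal := Ideal.subset_span (by simp)
    obtain ⟨p', hp⟩ := X_sub_C_dvd_sub_C_eval (a := P.x) (p := p)
    obtain ⟨q', hq⟩ := X_sub_C_dvd_sub_C_eval (a := P.x) (p := q)
    -- The constant terms at `P` combine to `q(X)(y - Y)`, because `p(X) = -Y q(X)`.
    have : C.func p q = C.func (X - Polynomial.C P.x) 0 * C.func p' q' +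
        C.func (-Polynomial.C P.y) 1 * C.func (Polynomial.C (q.eval P.x)) 0 := by
      rw [func_mul_left, func_mul, func_add, func_inj, ← hp, ← hq]
      refine ⟨?_, by ring⟩
      have h' := congrArg Polynomial.C h
      simp only [map_add, map_mul, map_zero] at h'
      linear_combination h'
    rw [this]
    exact add_mem (Ideal.mul_mem_right _ _ hx) (Ideal.mul_mem_right _ _ hy)

lemma maxIdeal_eq_ker (P : C.AffinePoint E) : P.maxIdeal = RingHom.ker P.evalHom := by
  ext a
  obtain ⟨p, q, rfl⟩ := C.exists_eq_func a
  rw [mem_maxIdeal, RingHom.mem_ker, evalHom_func]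

instance isMaximal_maxIdeal (P : C.AffinePoint E) : P.maxIdeal.IsMaximal := by
  rw [maxIdeal_eq_ker]
  refine RingHom.ker_isMaximal_of_surjective _ fun c => ⟨C.func (Polynomial.C c) 0, ?_⟩
  simp [evalHom_func]

/-- The order of vanishing at `P` of a Weierstrass coordinate: `2` at the fixed points of the
involution, `1` elsewhere. -/
def ram (P : C.AffinePoint E) : ℕ := open Classical in if P.y = 0 then 2 else 1

/-- The multiplier is `y + Y`, of value `2Y ≠ 0` at `P`. Both components of `(y + Y)(p + y q)`
vanish at `X` as soon as `p(X) + Y q(X) = 0`. -/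
lemma exists_local_x (P : C.AffinePoint E) (hy : P.y ≠ 0) :
    ∃ s ∉ P.maxIdeal, ∀ a ∈ P.maxIdeal, C.func (X - Polynomial.C P.x) 0 ∣ s * a := by
  refine ⟨C.func (Polynomial.C P.y) 1, ?_, ?_⟩
  · rw [mem_maxIdeal]
    simp only [eval_C, eval_one, mul_one, ← two_mul]
    exact mul_ne_zero (C.two_ne_zero_extension E) hy
  · intro a ha
    obtain ⟨p, q, rfl⟩ := C.exists_eq_func a
    rw [mem_maxIdeal] at ha
    rw [func_mul, func_dvd_iff, dvd_iff_isRoot, dvd_iff_isRoot]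
    have := P.equation
    rw [← C.eval_fE] at this
    constructor
    · simp only [IsRoot, eval_add, eval_mul, eval_C, one_mul, ← this]
      linear_combination P.y * ha
    · simp only [IsRoot, eval_add, eval_mul, eval_C, one_mul]
      linear_combination ha

lemma exists_fE_eq (P : C.AffinePoint E) (hy : P.y = 0) :
    ∃ r : E[X], C.fE E = (X - Polynomial.C P.x) * r ∧ r.eval P.x ≠ 0 := by
  have h0 : (C.fE E).eval P.x = 0 := by rw [C.eval_fE, ← P.equation, hy]; simp
  obtain ⟨r, hr⟩ := dvd_iff_isRoot.mpr h0
  refine ⟨r, hr, fun h => ?_⟩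
  have hs : (C.fE E).Separable := C.separable.map
  have := hs.eval₂_derivative_ne_zero (RingHom.id E) (x := P.x) (by simpa [eval₂_id] using h0)
  apply this
  rw [eval₂_id, hr]
  simp [derivative_mul, h]

/-- Here `X` is a simple root, so `y ^ 2 = (x - X) r` with `r(X) ≠ 0`, and `x - X` is a multiple of
`y` once `r` is inverted. -/
lemma exists_local_y (P : C.AffinePoint E) (hy : P.y = 0) :
    ∃ s ∉ P.maxIdeal, ∀ a ∈ P.maxIdeal, C.func 0 1 ∣ s * a := by
  obtain ⟨r, hr, hr0⟩ := P.exists_fE_eq hy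
  refine ⟨C.func r 0, ?_, ?_⟩
  · rw [mem_maxIdeal]; simpa using hr0
  · intro a ha
    obtain ⟨p, q, rfl⟩ := C.exists_eq_func a
    rw [mem_maxIdeal, hy] at ha
    obtain ⟨p', rfl⟩ := dvd_iff_isRoot.mpr (show p.IsRoot P.x by simpa using ha)
    refine ⟨C.func (r * q) p', ?_⟩
    rw [func_mul_left, func_mul, func_inj, hr]
    constructor <;> ring

/-- The pair `(π, s)` expresses that the maximal ideal is generated by `π` after inverting `s`,
without passing to the localization. -/
lemma exists_uniformizer (P : C.AffinePoint E) : ∃ π ∈ P.maxIdeal, π ≠ 0 ∧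
    ∃ s ∉ P.maxIdeal, ∀ a ∈ P.maxIdeal, π ∣ s * a := by
  by_cases hy : P.y = 0
  · exact ⟨_, mem_maxIdeal.mpr (by simp [hy]), by simp [func_eq_zero], P.exists_local_y hy⟩
  · exact ⟨_, mem_maxIdeal.mpr (by simp), by simp [func_eq_zero, X_sub_C_ne_zero],
      P.exists_local_x hy⟩

end AffinePoint

end CoordinateRing

end HECurve

/-! ### Additivity of the adic order at a locally principal maximal ideal. -/

section LocalOrder

variable {A : Type*} [CommRing A] {M : Ideal A} {π s : A}

lemma Ideal.mem_pow_of_mul_mem_of_notMem [M.IsMaximal] {a b : A} {k : ℕ} (ha : a ∉ M)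
    (h : a * b ∈ M ^ k) : b ∈ M ^ k := by
  have hcop : IsCoprime (Ideal.span {a}) (M ^ k) := by
    apply IsCoprime.pow_right
    obtain ⟨y, i, hi, h1⟩ := Ideal.IsMaximal.exists_inv inferInstance ha
    exact Ideal.isCoprime_iff_exists.mpr
      ⟨y * a, Ideal.mem_span_singleton'.mpr ⟨y, rfl⟩, i, hi, h1⟩
  obtain ⟨x, hx, y, hy, hxy⟩ := Ideal.isCoprime_iff_exists.mp hcop
  obtain ⟨c, rfl⟩ := Ideal.mem_span_singleton'.mp hx
  have : b = c * (a * b) + y * b := by linear_combination -b * hxy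
  rw [this]
  exact add_mem (Ideal.mul_mem_left _ _ h) (Ideal.mul_mem_right _ _ hy)

lemma Ideal.pow_dvd_pow_mul_of_mem_pow (hs : ∀ a ∈ M, π ∣ s * a) (k : ℕ) :
    ∀ a ∈ M ^ k, π ^ k ∣ s ^ k * a := by
  induction k with
  | zero => simp
  | succ k ih =>
    intro a ha
    rw [pow_succ] at ha
    refine Submodule.mul_induction_on ha (fun x hx y hy => ?_) (fun x y hx hy => ?_)
    · rw [pow_succ, pow_succ, mul_mul_mul_comm]
      exact mul_dvd_mul (ih x hx) (hs y hy)
    · rw [mul_add]; exact dvd_add hx hy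

/-- Write `s^k a = π^k c` and `s^l b = π^l d` with `c, d ∉ M`. Were `a b` one step deeper,
cancelling `π^(k+l)` would put `s c d` into the prime ideal `M`. -/
lemma Ideal.mul_notMem_pow [IsDomain A] [M.IsMaximal] (hπ : π ∈ M) (hπ0 : π ≠ 0) (hsM : s ∉ M)
    (hs : ∀ a ∈ M, π ∣ s * a) {a b : A} {k l : ℕ} (ha : a ∈ M ^ k) (ha' : a ∉ M ^ (k + 1))
    (hb : b ∈ M ^ l) (hb' : b ∉ M ^ (l + 1)) : a * b ∉ M ^ (k + l + 1) := by
  have hM : M.IsPrime := inferInstance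
  have key : ∀ {a : A} {k : ℕ}, a ∈ M ^ k → a ∉ M ^ (k + 1) →
      ∃ c ∉ M, s ^ k * a = π ^ k * c := by
    intro a k ha ha'
    obtain ⟨c, hc⟩ := Ideal.pow_dvd_pow_mul_of_mem_pow hs k a ha
    refine ⟨c, fun hcM => ha' ?_, hc⟩
    refine Ideal.mem_pow_of_mul_mem_of_notMem (a := s ^ k) (fun h => hsM (hM.mem_of_pow_mem _ h)) ?_
    rw [hc, pow_succ]
    exact Ideal.mul_mem_mul (Ideal.pow_mem_pow hπ k) hcM
  obtain ⟨c, hc, hac⟩ := key ha ha'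
  obtain ⟨d, hd, hbd⟩ := key hb hb'
  intro h
  obtain ⟨e, he⟩ := Ideal.pow_dvd_pow_mul_of_mem_pow hs _ _ h
  have h1 : π ^ (k + l) * (s * (c * d)) = π ^ (k + l) * (π * e) := by
    calc π ^ (k + l) * (s * (c * d)) = s * (π ^ k * c) * (π ^ l * d) := by ring
      _ = s ^ (k + l + 1) * (a * b) := by rw [← hac, ← hbd]; ring
      _ = _ := by rw [he]; ring
  have h2 := mul_left_cancel₀ (pow_ne_zero _ hπ0) h1
  have h3 : s * (c * d) ∈ M := h2 ▸ Ideal.mul_mem_right _ _ hπ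
  rcases hM.mem_or_mem h3 with h | h
  · exact hsM h
  · exact (hM.mem_or_mem h).elim hc hd

end LocalOrder

namespace HECurve

/-! ### Orders of functions at affine points. -/

section Order

variable {F : Type*} [Field F] {C : HECurve F} {E : Type*} [Field E] [Algebra F E]

/-- The order of vanishing of a function at an affine point. -/
def AffinePoint.ord (P : C.AffinePoint E) (a : C.CoordRing E) : ℕ :=
  sInf {k | a ∉ P.maxIdeal ^ (k + 1)}

namespace AffinePoint

variable (P : C.AffinePoint E)

/-- Krull's intersection theorem; it makes the infimum defining `ord` meaningful. -/
lemma exists_notMem_pow {a : C.CoordRing E} (ha : a ≠ 0) : ∃ k, a ∉ P.maxIdeal ^ (k + 1) := by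
  by_contra! h
  apply ha
  have h0 := Ideal.iInf_pow_eq_bot_of_isDomain P.maxIdeal (Ideal.IsMaximal.ne_top inferInstance)
  rw [← Ideal.mem_bot, ← h0, Ideal.mem_iInf]
  rintro (_ | k)
  · simp
  · exact h k

lemma mem_pow_iff {a : C.CoordRing E} (ha : a ≠ 0) {k : ℕ} :
    a ∈ P.maxIdeal ^ k ↔ k ≤ P.ord a := by
  have hne : {k | a ∉ P.maxIdeal ^ (k + 1)}.Nonempty := P.exists_notMem_pow ha
  constructor
  · intro h
    by_contra! hlt
    exact (Nat.sInf_mem hne : a ∉ _) (Ideal.pow_le_pow_right hlt h)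
  · rcases k with _ | k
    · simp
    · intro h
      by_contra hk
      have : P.ord a ≤ k := Nat.sInf_le hk
      omega

lemma ord_eq_iff {a : C.CoordRing E} (ha : a ≠ 0) {k : ℕ} :
    P.ord a = k ↔ a ∈ P.maxIdeal ^ k ∧ a ∉ P.maxIdeal ^ (k + 1) := by
  rw [P.mem_pow_iff ha, P.mem_pow_iff ha]; omega

lemma ord_pos_iff {a : C.CoordRing E} (ha : a ≠ 0) : 1 ≤ P.ord a ↔ a ∈ P.maxIdeal := by
  rw [← P.mem_pow_iff ha, pow_one]

lemma ord_mul {a b : C.CoordRing E} (ha : a ≠ 0) (hb : b ≠ 0) :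
    P.ord (a * b) = P.ord a + P.ord b := by
  obtain ⟨π, hπ, hπ0, s, hsM, hs⟩ := P.exists_uniformizer
  obtain ⟨h1, h2⟩ := (P.ord_eq_iff ha).mp rfl
  obtain ⟨h3, h4⟩ := (P.ord_eq_iff hb).mp rfl
  rw [P.ord_eq_iff (mul_ne_zero ha hb)]
  refine ⟨?_, Ideal.mul_notMem_pow hπ hπ0 hsM hs h1 h2 h3 h4⟩
  rw [pow_add]
  exact Ideal.mul_mem_mul h1 h3

lemma ord_one : P.ord 1 = 0 := by
  have := P.ord_mul (one_ne_zero) (one_ne_zero)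
  rw [mul_one] at this; omega

lemma ord_pow {a : C.CoordRing E} (ha : a ≠ 0) (k : ℕ) : P.ord (a ^ k) = k * P.ord a := by
  induction k with
  | zero => simp [ord_one]
  | succ k ih => rw [pow_succ, P.ord_mul (pow_ne_zero _ ha) ha, ih]; ring

end AffinePoint

end Order

variable {F : Type*} [Field F] {C : HECurve F} {E : Type*} [Field E] [Algebra F E]

namespace AffinePoint

variable (P : C.AffinePoint E)

lemma invol_invol : P.invol.invol = P := by
  ext <;> simp [invol]

lemma eq_invol_iff : P = P.invol ↔ P.y = 0 := by
  constructor
  · intro h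
    have h' : P.y = -P.y := congrArg AffinePoint.y h
    have : 2 * P.y = 0 := by linear_combination h'
    exact (mul_eq_zero.mp this).resolve_left (C.two_ne_zero_extension E)
  · intro h
    ext <;> simp [invol, h]

lemma ram_invol : P.invol.ram = P.ram := by
  by_cases h : P.y = 0 <;> simp [ram, invol, h]

lemma eq_or_eq_invol {P Q : C.AffinePoint E} (h : P.x = Q.x) : P = Q ∨ P = Q.invol := by
  have h2 : P.y ^ 2 = Q.y ^ 2 := by rw [P.equation, Q.equation, h]
  rcases sq_eq_sq_iff_eq_or_eq_neg.mp h2 with h' | h'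
  · exact Or.inl (AffinePoint.ext h h')
  · exact Or.inr (AffinePoint.ext h h')

lemma ord_eq_zero_iff {a : C.CoordRing E} (ha : a ≠ 0) : P.ord a = 0 ↔ a ∉ P.maxIdeal := by
  rw [← P.ord_pos_iff ha]; omega

lemma ord_uniformizer {π s : C.CoordRing E} (hπ : π ∈ P.maxIdeal) (hπ0 : π ≠ 0)
    (hsM : s ∉ P.maxIdeal) (hs : ∀ a ∈ P.maxIdeal, π ∣ s * a) : P.ord π = 1 := by
  rw [P.ord_eq_iff hπ0, pow_one]
  refine ⟨hπ, fun h => ?_⟩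
  have hM : P.maxIdeal.IsPrime := inferInstance
  obtain ⟨c, hc⟩ := Ideal.pow_dvd_pow_mul_of_mem_pow hs _ _ h
  have : s ^ 2 = π * c := by
    apply mul_left_cancel₀ hπ0
    linear_combination hc
  exact hsM (hM.mem_of_pow_mem 2 (this ▸ Ideal.mul_mem_right _ _ hπ))

lemma ord_y (hy : P.y = 0) : P.ord (C.func 0 1) = 1 := by
  obtain ⟨s, hsM, hs⟩ := P.exists_local_y hy
  exact P.ord_uniformizer (mem_maxIdeal.mpr (by simp [hy])) (by simp [func_eq_zero]) hsM hs

lemma ord_of_eval_ne_zero {p : E[X]} (h : p.eval P.x ≠ 0) : P.ord (C.func p 0) = 0 := by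
  have hp : p ≠ 0 := fun h' => h (by simp [h'])
  rw [P.ord_eq_zero_iff (by simp [func_eq_zero, hp]), mem_maxIdeal]
  simpa using h

lemma ord_X_sub_C : P.ord (C.func (X - Polynomial.C P.x) 0) = P.ram := by
  have h0 : C.func (X - Polynomial.C P.x) 0 ≠ 0 := by simp [func_eq_zero, X_sub_C_ne_zero]
  by_cases hy : P.y = 0
  · rw [ram, if_pos hy]
    obtain ⟨r, hr, hr0⟩ := P.exists_fE_eq hy
    -- The order is `2` because `(x - X) r = y ^ 2`, with `r` a local unit and `y` of order `1`.
    have hr' : C.func r 0 ≠ 0 := by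
      rw [Ne, func_eq_zero]; rintro ⟨rfl, -⟩; simp at hr0
    have h1 : C.func (X - Polynomial.C P.x) 0 * C.func r 0 = C.func 0 1 ^ 2 := by
      rw [sq (C.func 0 1), func_mul_left, func_mul, ← hr]; simp
    have h2 := congrArg P.ord h1
    rw [P.ord_mul h0 hr', P.ord_of_eval_ne_zero hr0, P.ord_pow (by simp [func_eq_zero]),
      P.ord_y hy] at h2
    omega
  · rw [ram, if_neg hy]
    obtain ⟨s, hsM, hs⟩ := P.exists_local_x hy
    exact P.ord_uniformizer (mem_maxIdeal.mpr (by simp)) h0 hsM hs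

lemma ord_func_poly {p : E[X]} (hp : p ≠ 0) :
    P.ord (C.func p 0) = P.ram * p.rootMultiplicity P.x := by
  obtain ⟨q, hq, hq0⟩ := exists_eq_pow_rootMultiplicity_mul_and_not_dvd p hp P.x
  rw [dvd_iff_isRoot] at hq0
  have h1 : C.func p 0 = C.func (X - Polynomial.C P.x) 0 ^ (p.rootMultiplicity P.x) *
      C.func q 0 := by
    rw [← func_pow, func_mul_left, ← hq]; simp
  have hq' : q ≠ 0 := by rintro rfl; simp at hq0
  have h0 : C.func (X - Polynomial.C P.x) 0 ≠ 0 := by simp [func_eq_zero, X_sub_C_ne_zero]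
  rw [h1, P.ord_mul (pow_ne_zero _ h0) (by simp [func_eq_zero, hq']), P.ord_pow h0,
    P.ord_of_eval_ne_zero hq0, P.ord_X_sub_C]
  ring

lemma ord_func_poly_invol (p : E[X]) : P.invol.ord (C.func p 0) = P.ord (C.func p 0) := by
  by_cases hp : p = 0
  -- The zero function has order `sInf ∅ = 0` by default, at every point.
  · subst hp; rw [func_zero]; simp [ord]
  · rw [ord_func_poly _ hp, ord_func_poly _ hp, ram_invol]; rfl

/-- Away from ramification, the values at `P` and `w(P)` separate `p(X)` from `q(X)` since `2Y ≠ 0`.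
At a ramified point `p(X) = 0` gives `p` order at least `2`, while `y q` has order exactly `1`
unless `q(X) = 0`. -/
lemma ord_X_sub_C_le_iff {p q : E[X]} (h : C.func p q ≠ 0) :
    (P.ram ≤ P.ord (C.func p q) ∧ P.ram ≤ P.invol.ord (C.func p q)) ↔
      p.eval P.x = 0 ∧ q.eval P.x = 0 := by
  constructor
  · rintro ⟨h1, h2⟩
    have hr : 1 ≤ P.ram := by unfold ram; split_ifs <;> norm_num
    have h3 := (P.ord_pos_iff h).mp (hr.trans h1)
    have h4 := (P.invol.ord_pos_iff h).mp (hr.trans h2)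
    rw [mem_maxIdeal] at h3 h4
    simp only [invol] at h4
    by_cases hy : P.y = 0
    · rw [hy, zero_mul, add_zero] at h3
      refine ⟨h3, ?_⟩
      by_contra hq
      have hq' : q ≠ 0 := by rintro rfl; simp at hq
      rw [ram, if_pos hy, ← P.mem_pow_iff h] at h1
      have h5 : C.func p 0 ∈ P.maxIdeal ^ 2 := by
        obtain ⟨r, rfl⟩ := dvd_iff_isRoot.mpr (show p.IsRoot P.x from h3)
        rw [← mul_zero (X - Polynomial.C P.x), ← func_mul_left]
        refine Ideal.mul_mem_right _ _ ?_
        rw [P.mem_pow_iff (by simp [func_eq_zero, X_sub_C_ne_zero]), ord_X_sub_C, ram, if_pos hy]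
      have h6 : C.func 0 q ∈ P.maxIdeal ^ 2 := by
        have := sub_mem h1 h5
        rwa [show C.func p q - C.func p 0 = C.func 0 q by simp [func]] at this
      rw [P.mem_pow_iff (by simp [func_eq_zero, hq']),
        show C.func 0 q = C.func q 0 * C.func 0 1 by rw [func_mul_left]; simp,
        P.ord_mul (by simp [func_eq_zero, hq']) (by simp [func_eq_zero]), P.ord_y hy,
        P.ord_of_eval_ne_zero hq] at h6
      omega
    · have h5 : 2 * P.y * q.eval P.x = 0 := by linear_combination h3 - h4
      have h6 := (mul_eq_zero.mp h5).resolve_left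
        (mul_ne_zero (C.two_ne_zero_extension E) hy)
      rw [h6] at h3
      exact ⟨by simpa using h3, h6⟩
  · rintro ⟨h1, h2⟩
    obtain ⟨p', rfl⟩ := dvd_iff_isRoot.mpr (show p.IsRoot P.x from h1)
    obtain ⟨q', rfl⟩ := dvd_iff_isRoot.mpr (show q.IsRoot P.x from h2)
    rw [← func_mul_left] at h ⊢
    have h3 := left_ne_zero_of_mul h
    have h4 := right_ne_zero_of_mul h
    rw [ord_mul _ h3 h4, ord_mul _ h3 h4, ord_func_poly_invol, ord_X_sub_C]
    exact ⟨Nat.le_add_right _ _, Nat.le_add_right _ _⟩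

end AffinePoint

/-! ### Divisibility by polynomials in `x`, tested on orders. -/

lemma exists_affinePoint [IsAlgClosed E] (x : E) : ∃ P : C.AffinePoint E, P.x = x := by
  obtain ⟨y, hy⟩ := IsAlgClosed.exists_pow_nat_eq (aeval x C.f) (n := 2) (by norm_num)
  exact ⟨⟨x, y, hy⟩, rfl⟩

lemma func_dvd_iff_ord_le [IsAlgClosed E] {r p q : E[X]} (hr : r ≠ 0) (h : C.func p q ≠ 0) :
    C.func r 0 ∣ C.func p q ↔
      ∀ P : C.AffinePoint E, P.ord (C.func r 0) ≤ P.ord (C.func p q) := by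
  constructor
  · rintro ⟨a, ha⟩ P
    rw [ha] at h ⊢
    rw [P.ord_mul (left_ne_zero_of_mul h) (right_ne_zero_of_mul h)]
    omega
  · induction hd : r.natDegree generalizing r p q with
    | zero =>
      intro _
      rw [natDegree_eq_zero] at hd
      obtain ⟨c, rfl⟩ := hd
      have hc : IsUnit (Polynomial.C c) := isUnit_C.mpr (isUnit_iff_ne_zero.mpr (by simpa using hr))
      exact C.func_dvd_iff.mpr ⟨hc.dvd, hc.dvd⟩
    | succ d ih =>
      intro hord
      obtain ⟨x, hx⟩ := IsAlgClosed.exists_root r (by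
        rw [degree_eq_natDegree hr, hd]; exact_mod_cast Nat.succ_ne_zero d)
      obtain ⟨P, rfl⟩ := C.exists_affinePoint x
      obtain ⟨r', rfl⟩ := dvd_iff_isRoot.mpr hx
      have hr' : r' ≠ 0 := right_ne_zero_of_mul hr
      have hl : C.func (X - Polynomial.C P.x) 0 ≠ 0 := by simp [func_eq_zero, X_sub_C_ne_zero]
      have e : C.func ((X - Polynomial.C P.x) * r') 0 =
          C.func (X - Polynomial.C P.x) 0 * C.func r' 0 := by rw [func_mul_left]; simp
      have hr'' : C.func r' 0 ≠ 0 := by simp [func_eq_zero, hr']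
      have h1 := hord P
      have h2 := hord P.invol
      rw [e, AffinePoint.ord_mul _ hl hr''] at h1 h2
      rw [P.ord_func_poly_invol, P.ord_X_sub_C] at h2
      rw [P.ord_X_sub_C] at h1
      -- The order bounds at `P` and `w(P)` let one linear factor of `r` be cancelled.
      obtain ⟨hp, hq⟩ := (P.ord_X_sub_C_le_iff h).mp ⟨by omega, by omega⟩
      obtain ⟨p', rfl⟩ := dvd_iff_isRoot.mpr (show p.IsRoot P.x from hp)
      obtain ⟨q', rfl⟩ := dvd_iff_isRoot.mpr (show q.IsRoot P.x from hq)
      rw [← func_mul_left] at h hord ⊢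
      have h' := right_ne_zero_of_mul h
      rw [e]
      refine mul_dvd_mul_left _ (ih hr' h' ?_ ?_)
      · rw [natDegree_mul (X_sub_C_ne_zero _) hr', natDegree_X_sub_C] at hd; omega
      · intro Q
        have := hord Q
        rw [e, Q.ord_mul hl hr'', Q.ord_mul hl h'] at this
        omega

/-! ### Principal divisors. -/

lemma hasDivisor_iff {p q : E[X]} {D : C.Divisor E} : C.HasDivisor p q D ↔
    C.func p q ≠ 0 ∧ (∀ P : C.AffinePoint E, D (some P) = P.ord (C.func p q)) ∧
      D none = -(C.poleOrder p q : ℤ) := by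
  have h0 : (p ≠ 0 ∨ q ≠ 0) ↔ C.func p q ≠ 0 := by
    rw [← not_iff_not, not_not, func_eq_zero]; tauto
  rw [HasDivisor, h0]
  refine and_congr_right fun h => and_congr_left fun _ => forall_congr' fun P => ?_
  constructor
  · rintro ⟨k, hk, h1⟩
    rw [hk, (P.ord_eq_iff h).mpr h1]
  · intro hk
    exact ⟨_, hk, (P.ord_eq_iff h).mp rfl⟩

/-- The two terms of the norm have degrees of different parity, so none cancels. Multiplicativity of
the norm then gives additivity of pole orders. -/
lemma poleOrder_eq {p q : E[X]} (h : C.func p q ≠ 0) :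
    p ^ 2 - C.fE E * q ^ 2 ≠ 0 ∧ C.poleOrder p q = (p ^ 2 - C.fE E * q ^ 2).natDegree := by
  rw [Ne, func_eq_zero] at h
  by_cases hq : q = 0
  · subst hq
    have hp : p ≠ 0 := by tauto
    simp [poleOrder, hp]
  · have h1 : (C.fE E * q ^ 2).natDegree = 2 * q.natDegree + (2 * C.g + 1) := by
      rw [C.monic_fE.natDegree_mul' (pow_ne_zero _ hq), natDegree_pow, natDegree_fE]; omega
    have h2 : (p ^ 2).natDegree = 2 * p.natDegree := natDegree_pow _ _
    rw [poleOrder, if_neg hq]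
    rcases lt_or_gt_of_ne (show 2 * p.natDegree ≠ 2 * q.natDegree + (2 * C.g + 1) by omega)
      with hlt | hlt
    · have h3 := natDegree_sub_eq_right_of_natDegree_lt (p := p ^ 2) (q := C.fE E * q ^ 2)
        (by omega)
      refine ⟨fun h => ?_, by rw [h3]; omega⟩
      rw [h] at h3; simp only [natDegree_zero] at h3; omega
    · have h3 := natDegree_sub_eq_left_of_natDegree_lt (p := p ^ 2) (q := C.fE E * q ^ 2)
        (by omega)
      refine ⟨fun h => ?_, by rw [h3]; omega⟩
      rw [h] at h3; simp only [natDegree_zero] at h3; omega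

lemma HasDivisor.mul {p q p' q' : E[X]} {D D' : C.Divisor E} (h : C.HasDivisor p q D)
    (h' : C.HasDivisor p' q' D') :
    C.HasDivisor (p * p' + C.fE E * (q * q')) (p * q' + q * p') (D + D') := by
  rw [hasDivisor_iff] at *
  obtain ⟨h1, h2, h3⟩ := h
  obtain ⟨h1', h2', h3'⟩ := h'
  have hne := mul_ne_zero h1 h1'
  refine ⟨by rwa [← func_mul], fun P => ?_, ?_⟩
  · rw [← func_mul, P.ord_mul h1 h1', Finsupp.add_apply, h2, h2']; push_cast; rfl
  · rw [func_mul] at hne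
    obtain ⟨n1, e1⟩ := poleOrder_eq h1
    obtain ⟨n2, e2⟩ := poleOrder_eq h1'
    obtain ⟨n3, e3⟩ := poleOrder_eq hne
    have e : (p * p' + C.fE E * (q * q')) ^ 2 - C.fE E * (p * q' + q * p') ^ 2 =
        (p ^ 2 - C.fE E * q ^ 2) * (p' ^ 2 - C.fE E * q' ^ 2) := by ring
    rw [Finsupp.add_apply, h3, h3', e1, e2, e3, e, natDegree_mul n1 n2]; push_cast; ring

lemma hasDivisor_one : C.HasDivisor (1 : E[X]) 0 0 := by
  rw [hasDivisor_iff]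
  simp [func_one, AffinePoint.ord_one, poleOrder]

lemma exists_hasDivisor_sub_of_mem_principal {D : C.Divisor E} (hD : D ∈ C.principal E) :
    ∃ (p q p' q' : E[X]) (A B : C.Divisor E), C.HasDivisor p q A ∧ C.HasDivisor p' q' B ∧
      D = A - B := by
  induction hD using AddSubgroup.closure_induction with
  | mem x hx =>
    obtain ⟨p, q, h⟩ := hx
    exact ⟨p, q, 1, 0, x, 0, h, hasDivisor_one, by simp⟩
  | zero => exact ⟨1, 0, 1, 0, 0, 0, hasDivisor_one, hasDivisor_one, by simp⟩
  | add x y _ _ hx hy =>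
    obtain ⟨_, _, _, _, A, B, hA, hB, rfl⟩ := hx
    obtain ⟨_, _, _, _, A', B', hA', hB', rfl⟩ := hy
    exact ⟨_, _, _, _, _, _, hA.mul hA', hB.mul hB', by abel⟩
  | neg x _ hx =>
    obtain ⟨_, _, _, _, A, B, hA, hB, rfl⟩ := hx
    exact ⟨_, _, _, _, _, _, hB, hA, by abel⟩

/-- A principal divisor without affine poles is the divisor of a polynomial function. -/
lemma exists_hasDivisor_of_mem_principal [IsAlgClosed E] {D : C.Divisor E}
    (hD : D ∈ C.principal E) (h0 : AffineLE 0 D) : ∃ p q : E[X], C.HasDivisor p q D := by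
  obtain ⟨p, q, p', q', A, B, hA, hB, rfl⟩ := exists_hasDivisor_sub_of_mem_principal hD
  have hA' := hasDivisor_iff.mp hA
  have hB' := hasDivisor_iff.mp hB
  have hcne : C.func p' (-q') ≠ 0 := by
    have := hB'.1
    rw [Ne, func_eq_zero] at this ⊢
    simpa using this
  -- Rationalize the quotient: the conjugate `p' - y q'` turns the denominator into the polynomial
  -- `N(x)`, for which divisibility can be tested on orders.
  set N := p' ^ 2 - C.fE E * q' ^ 2 with hN
  have hN0 : N ≠ 0 := (poleOrder_eq hB'.1).1
  have hnorm : C.func p' q' * C.func p' (-q') = C.func N 0 := by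
    rw [func_mul, func_inj, hN]; constructor <;> ring
  have hprod := mul_ne_zero hA'.1 hcne
  have hdvd : C.func N 0 ∣ C.func p q * C.func p' (-q') := by
    rw [func_mul] at hprod ⊢
    rw [func_dvd_iff_ord_le hN0 hprod]
    intro P
    rw [← func_mul, ← hnorm, P.ord_mul hA'.1 hcne, P.ord_mul hB'.1 hcne]
    have h1 := hA'.2.1 P
    have h2 := hB'.2.1 P
    have h3 := h0 P
    rw [Finsupp.sub_apply, h1, h2] at h3
    simp only [Finsupp.coe_zero, Pi.zero_apply] at h3
    omega
  obtain ⟨c, hc⟩ := hdvd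
  have hab : C.func p q = C.func p' q' * c := by
    apply mul_right_cancel₀ hcne
    rw [hc, ← hnorm]; ring
  obtain ⟨a, b, rfl⟩ := C.exists_eq_func c
  have hne : C.func a b ≠ 0 := by rintro h; rw [h, mul_zero] at hab; exact hA'.1 hab
  refine ⟨a, b, hasDivisor_iff.mpr ⟨hne, fun P => ?_, ?_⟩⟩
  · rw [Finsupp.sub_apply, hA'.2.1, hB'.2.1, hab, P.ord_mul hB'.1 hne]; push_cast; ring
  · have h4 := poleOrder_eq hA'.1
    have h5 := poleOrder_eq hB'.1
    have h6 := poleOrder_eq hne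
    rw [func_mul, func_inj] at hab
    have e : p ^ 2 - C.fE E * q ^ 2 = (p' ^ 2 - C.fE E * q' ^ 2) * (a ^ 2 - C.fE E * b ^ 2) := by
      rw [hab.1, hab.2]; ring
    rw [Finsupp.sub_apply, hA'.2.2, hB'.2.2, h4.2, h5.2, h6.2, e, natDegree_mul h5.1 h6.1]
    push_cast; ring

/-! ### The involution and uniqueness of reduced divisors. -/

lemma w_apply_some (D : C.Divisor E) (P : C.AffinePoint E) : w D (some P) = D (some P.invol) := by
  have hinj : Function.Injective (Option.map (AffinePoint.invol (C := C) (E := E))) :=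
    Option.map_injective fun P Q h => by
      rw [← P.invol_invol, h, Q.invol_invol]
  have := Finsupp.mapDomain_apply hinj D (some P.invol)
  rwa [Option.map_some, P.invol_invol] at this

lemma w_apply_none (D : C.Divisor E) : w D none = D none := by
  have hinj : Function.Injective (Option.map (AffinePoint.invol (C := C) (E := E))) :=
    Option.map_injective fun P Q h => by
      rw [← P.invol_invol, h, Q.invol_invol]
  exact Finsupp.mapDomain_apply hinj D none

lemma divisor_ext {D D' : C.Divisor E} (h : ∀ P, D (some P) = D' (some P))
    (h' : D none = D' none) : D = D' := by
  ext (_ | P)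
  · exact h'
  · exact h P

lemma w_single (P : C.Point E) (c : ℤ) :
    w (Finsupp.single P c) = Finsupp.single (P.map AffinePoint.invol) c := by
  simp [w, Finsupp.mapDomain_single]

/-- The divisor of `x - X`. -/
lemma hasDivisor_X_sub_C (P : C.AffinePoint E) : C.HasDivisor (X - Polynomial.C P.x) 0
    (Finsupp.single (some P) 1 - Finsupp.single none 1 +
      w (Finsupp.single (some P) 1 - Finsupp.single none 1)) := by
  classical
  rw [hasDivisor_iff]
  refine ⟨by simp [func_eq_zero, X_sub_C_ne_zero], fun Q => ?_, ?_⟩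
  · rw [Finsupp.add_apply, w_apply_some]
    simp only [Finsupp.sub_apply, Finsupp.single_apply, Option.some.injEq, reduceCtorEq,
      if_false, sub_zero]
    by_cases hx : Q.x = P.x
    · have e : X - Polynomial.C P.x = X - Polynomial.C Q.x := by rw [hx]
      rw [e, Q.ord_X_sub_C, AffinePoint.ram]
      have hQ := P.eq_invol_iff
      rcases AffinePoint.eq_or_eq_invol hx with rfl | rfl
      · by_cases hy : Q.y = 0
        · have h1 := (hQ.mpr hy).symm
          simp [hy, h1]
        · have := mt hQ.mp hy
          simp [hy, this]
      · by_cases hy : P.y = 0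
        · have h1 := (hQ.mpr hy).symm
          simp [hy, h1]
        · have := mt hQ.mp hy
          simp [AffinePoint.invol_invol, this]
          simp [AffinePoint.invol, hy]
    · rw [Q.ord_of_eval_ne_zero (by simpa [sub_eq_zero] using hx)]
      have h1 : P ≠ Q := by rintro rfl; exact hx rfl
      have h2 : P ≠ Q.invol := by rintro rfl; exact hx rfl
      simp [h1, h2]
  · rw [Finsupp.add_apply, w_apply_none]
    simp [poleOrder]

lemma ofPoints_eq {r : ℕ} (P : Fin r → C.AffinePoint E) :
    ofPoints P = ∑ i, (Finsupp.single (some (P i)) 1 - Finsupp.single none 1 : C.Divisor E) := by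
  rw [ofPoints, Finset.sum_sub_distrib]
  congr 1
  ext a
  simp [Finsupp.single_apply]

/-- Each `P_i + w(P_i) - 2O` is the divisor of `x - X_i`. Thus `w` acts as `-1` on the classes of
such divisors. -/
lemma add_w_mem_principal {r : ℕ} (P : Fin r → C.AffinePoint E) :
    ofPoints P + w (ofPoints P) ∈ C.principal E := by
  rw [ofPoints_eq, map_sum, ← Finset.sum_add_distrib]
  exact AddSubgroup.sum_mem _ fun i _ =>
    AddSubgroup.subset_closure ⟨_, _, hasDivisor_X_sub_C (P i)⟩

lemma IsReduced.add_w_mem_principal {D : C.Divisor E} (h : IsReduced D) :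
    D + w D ∈ C.principal E := by
  obtain ⟨r, P, -, rfl, -⟩ := h
  exact HECurve.add_w_mem_principal P

lemma ofPoints_apply_some {r : ℕ} (P : Fin r → C.AffinePoint E) (Q : C.AffinePoint E) :
    ofPoints P (some Q) = ∑ i, open Classical in if P i = Q then (1 : ℤ) else 0 := by
  classical
  simp only [ofPoints, Finsupp.sub_apply, Finsupp.finsetSum_apply, Finsupp.single_apply]
  simp

lemma ofPoints_apply_none {r : ℕ} (P : Fin r → C.AffinePoint E) :
    ofPoints P none = -r := by
  simp [ofPoints]

lemma ofPoints_apply_some_nonneg {r : ℕ} (P : Fin r → C.AffinePoint E) (Q : C.AffinePoint E) :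
    0 ≤ ofPoints P (some Q) := by
  rw [ofPoints_apply_some]
  exact Finset.sum_nonneg fun i _ => by split_ifs <;> norm_num

lemma exists_of_ofPoints_ne_zero {r : ℕ} {P : Fin r → C.AffinePoint E} {Q : C.AffinePoint E}
    (h : ofPoints P (some Q) ≠ 0) : ∃ i, P i = Q := by
  rw [ofPoints_apply_some] at h
  obtain ⟨i, -, hi⟩ := Finset.exists_ne_zero_of_sum_ne_zero h
  exact ⟨i, by by_contra h'; simp [h'] at hi⟩

lemma IsReduced.nonneg {D : C.Divisor E} (h : IsReduced D) (Q : C.AffinePoint E) :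
    0 ≤ D (some Q) := by
  obtain ⟨r, P, -, rfl, -⟩ := h
  exact ofPoints_apply_some_nonneg P Q

lemma IsReduced.none_ge {D : C.Divisor E} (h : IsReduced D) : -(C.g : ℤ) ≤ D none := by
  obtain ⟨r, P, hr, rfl, -⟩ := h
  rw [ofPoints_apply_none]; omega

lemma IsReduced.eq_zero_or {D : C.Divisor E} (h : IsReduced D) {Q : C.AffinePoint E}
    (hQ : Q ≠ Q.invol) : D (some Q) = 0 ∨ D (some Q.invol) = 0 := by
  obtain ⟨r, P, -, rfl, hP⟩ := h
  by_contra! hne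
  obtain ⟨i, hi⟩ := exists_of_ofPoints_ne_zero hne.1
  obtain ⟨j, hj⟩ := exists_of_ofPoints_ne_zero hne.2
  refine hP i j ?_ ?_
  · rintro rfl; exact hQ (hi.symm.trans hj)
  · rw [hi, hj, Q.invol_invol]

lemma IsReduced.le_one {D : C.Divisor E} (h : IsReduced D) {Q : C.AffinePoint E}
    (hQ : Q = Q.invol) : D (some Q) ≤ 1 := by
  classical
  obtain ⟨r, P, -, rfl, hP⟩ := h
  rw [ofPoints_apply_some]
  have : ∀ i j, P i = Q → P j = Q → i = j := by
    intro i j hi hj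
    by_contra hij
    exact hP i j hij (by rw [hi, hj]; exact hQ)
  by_cases hex : ∃ i, P i = Q
  · obtain ⟨i, hi⟩ := hex
    rw [Finset.sum_eq_single i]
    · rw [if_pos hi]
    · intro j _ hj
      rw [if_neg]
      exact fun hjQ => hj (this j i hjQ hi)
    · simp
  · push Not at hex
    simp [hex]

lemma degree_ofPoints {r : ℕ} (P : Fin r → C.AffinePoint E) :
    Finsupp.degree (ofPoints P) = 0 := by
  rw [ofPoints_eq, map_sum]
  simp

/-- Linearly equivalent reduced divisors are equal. -/
lemma IsReduced.eq_of_sub_mem_principal [IsAlgClosed E] {D D' : C.Divisor E} (h : IsReduced D)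
    (h' : IsReduced D') (hp : D - D' ∈ C.principal E) : D = D' := by
  have h1 : D + w D' ∈ C.principal E := by
    have := add_mem hp h'.add_w_mem_principal
    rwa [show D - D' + (D' + w D') = D + w D' by abel] at this
  obtain ⟨p, q, hd⟩ := exists_hasDivisor_of_mem_principal h1 (fun P => by
    simp only [Finsupp.add_apply, w_apply_some, Finsupp.coe_zero, Pi.zero_apply]
    exact add_nonneg (h.nonneg _) (h'.nonneg _))
  rw [hasDivisor_iff] at hd
  obtain ⟨hne, hd1, hd2⟩ := hd
  -- The pole of `D + w(D')` at `O` has order at most `2g`, whereas a nonzero `y q` has a pole of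
  -- order at least `2g + 1`.
  have hq : q = 0 := by
    by_contra hq
    rw [Finsupp.add_apply, w_apply_none, poleOrder, if_neg hq] at hd2
    have := h.none_ge
    have := h'.none_ge
    omega
  subst hq
  have hp0 : p ≠ 0 := by rw [Ne, func_eq_zero] at hne; tauto
  -- A function of `x` alone has equal orders at `P` and `w(P)`, and each reduced divisor meets at
  -- most one of them. At a fixed point the order is even and both coefficients are at most `1`.
  have haff : ∀ P : C.AffinePoint E, D (some P) = D' (some P) := by
    intro P
    have e1 := hd1 P
    have e2 := hd1 P.invol
    rw [P.ord_func_poly_invol] at e2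
    rw [Finsupp.add_apply, w_apply_some] at e1 e2
    rw [P.invol_invol] at e2
    have n1 := h.nonneg P
    have n2 := h'.nonneg P
    have n3 := h.nonneg P.invol
    have n4 := h'.nonneg P.invol
    by_cases hP : P = P.invol
    · have m1 := h.le_one hP
      have m2 := h'.le_one hP
      rw [← hP, P.ord_func_poly hp0, AffinePoint.ram, if_pos (P.eq_invol_iff.mp hP)] at e1
      push_cast at e1
      omega
    · have m1 := h.eq_zero_or hP
      have m2 := h'.eq_zero_or hP
      omega
  refine divisor_ext haff ?_
  obtain ⟨r, P, -, rfl, -⟩ := h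
  obtain ⟨r', P', -, rfl, -⟩ := h'
  -- The coefficients at `O` agree because both divisors have degree zero.
  have hs : ofPoints P - ofPoints P' =
      Finsupp.single none (ofPoints P none - ofPoints P' none) := by
    refine divisor_ext (fun Q => ?_) ?_
    · rw [Finsupp.sub_apply, haff Q]; simp
    · simp
  have hdeg := congrArg (Finsupp.degree : C.Divisor E →+ ℤ) hs
  rw [map_sub, degree_ofPoints, degree_ofPoints, Finsupp.degree_single] at hdeg
  omega

lemma w_w (D : C.Divisor E) : w (w D) = D :=
  divisor_ext (fun P => by rw [w_apply_some, w_apply_some, P.invol_invol])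
    (by rw [w_apply_none, w_apply_none])

lemma w_ofPoints {r : ℕ} (P : Fin r → C.AffinePoint E) :
    w (ofPoints P) = ofPoints fun i => (P i).invol := by
  simp only [ofPoints, map_sub, map_sum, w_single, Option.map_some, Option.map_none]

lemma IsReduced.w {D : C.Divisor E} (h : IsReduced D) : IsReduced (w D) := by
  obtain ⟨r, P, hr, rfl, hP⟩ := h
  refine ⟨r, _, hr, w_ofPoints P, fun i j hij he => hP i j hij ?_⟩
  rw [← (P i).invol_invol, he, AffinePoint.invol_invol]

/-! ### Automorphisms of `E / F` preserve orders. -/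

section Conjugation

variable {F : Type*} [Field F] {C : HECurve F} {E : Type*} [Field E] [Algebra F E]

lemma map_fE (σ : E →ₐ[F] E) : (C.fE E).map σ.toRingHom = C.fE E := by
  rw [Polynomial.map_map]; congr 1; ext x; simp

/-- The action of an automorphism of `E / F` on affine points. -/
def AffinePoint.conj (σ : E →ₐ[F] E) (P : C.AffinePoint E) : C.AffinePoint E where
  x := σ P.x
  y := σ P.y
  equation := by rw [← map_pow, P.equation, aeval_algHom_apply]

/-- The action of an automorphism of `E / F` on the coordinate ring. -/
def conjRing (C : HECurve F) (σ : E →ₐ[F] E) : C.CoordRing E →+* C.CoordRing E :=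
  AdjoinRoot.lift ((AdjoinRoot.of _).comp (mapRingHom σ.toRingHom)) (AdjoinRoot.root _) (by
    have h := C.root_sq (E := E)
    simp only [eval₂_sub, eval₂_pow, eval₂_X, eval₂_C, RingHom.comp_apply, coe_mapRingHom]
    rw [map_fE, h, sub_self])

lemma conjRing_func (σ : E →ₐ[F] E) (p q : E[X]) :
    C.conjRing σ (C.func p q) = C.func (p.map σ.toRingHom) (q.map σ.toRingHom) := by
  simp only [conjRing, func, map_add, map_mul, AdjoinRoot.lift_of, AdjoinRoot.lift_root,
    RingHom.comp_apply, coe_mapRingHom]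

lemma conjRing_mem_maxIdeal_pow (σ : E →ₐ[F] E) {P : C.AffinePoint E} {a : C.CoordRing E} {k : ℕ}
    (ha : a ∈ P.maxIdeal ^ k) : C.conjRing σ a ∈ (P.conj σ).maxIdeal ^ k := by
  have h1 : P.maxIdeal.map (C.conjRing σ) ≤ (P.conj σ).maxIdeal := by
    rw [AffinePoint.maxIdeal, Ideal.map_span, Ideal.span_le]
    rintro _ ⟨_, rfl | rfl, rfl⟩ <;> rw [conjRing_func] <;>
      simp [AffinePoint.mem_maxIdeal, AffinePoint.conj]
  have h2 := Ideal.mem_map_of_mem (C.conjRing σ) ha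
  rw [Ideal.map_pow] at h2
  exact Ideal.pow_right_mono h1 k h2

lemma ord_conjRing (σ : E ≃ₐ[F] E) {p q : E[X]} (h : C.func p q ≠ 0)
    (P : C.AffinePoint E) : (P.conj σ.toAlgHom).ord (C.conjRing σ.toAlgHom (C.func p q)) =
      P.ord (C.func p q) := by
  have h' : C.conjRing σ.toAlgHom (C.func p q) ≠ 0 := by
    rw [conjRing_func, Ne, func_eq_zero]
    rw [Ne, func_eq_zero] at h
    rwa [Polynomial.map_eq_zero_iff σ.injective, Polynomial.map_eq_zero_iff σ.injective]
  refine ((AffinePoint.ord_eq_iff _ h').mpr ⟨?_, fun hm => ?_⟩)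
  · exact conjRing_mem_maxIdeal_pow _ ((P.mem_pow_iff h).mpr le_rfl)
  · have := conjRing_mem_maxIdeal_pow σ.symm.toAlgHom hm
    have e1 : (P.conj σ.toAlgHom).conj σ.symm.toAlgHom = P := by
      ext <;> simp [AffinePoint.conj]
    have e2 : C.conjRing σ.symm.toAlgHom (C.conjRing σ.toAlgHom (C.func p q)) = C.func p q := by
      have : (σ.symm.toAlgHom.toRingHom).comp σ.toAlgHom.toRingHom = RingHom.id E := by
        ext x; simp
      rw [conjRing_func, conjRing_func, Polynomial.map_map, Polynomial.map_map, this]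
      simp
    rw [e1, e2, P.mem_pow_iff h] at this
    omega

end Conjugation

/-! ### Frobenius on divisors, and traces. -/

section Frobenius

variable {F : Type*} [Field F] [Fintype F] {C : HECurve F} {E : Type*} [Field E] [Algebra F E]

lemma pow_card_injective : Function.Injective fun x : E => x ^ Fintype.card F :=
  (FiniteField.frobeniusAlgHom F E).injective

namespace AffinePoint

lemma frob_injective : Function.Injective (frob : C.AffinePoint E → C.AffinePoint E) := by
  intro P Q h
  exact AffinePoint.ext (pow_card_injective (F := F) (congrArg AffinePoint.x h))
    (pow_card_injective (F := F) (congrArg AffinePoint.y h))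

lemma frob_surjective [IsAlgClosed E] :
    Function.Surjective (frob : C.AffinePoint E → C.AffinePoint E) := by
  intro P
  obtain ⟨x, hx⟩ := IsAlgClosed.exists_pow_nat_eq P.x (Fintype.card_pos (α := F))
  obtain ⟨y, hy⟩ := IsAlgClosed.exists_pow_nat_eq P.y (Fintype.card_pos (α := F))
  refine ⟨⟨x, y, pow_card_injective (F := F) ?_⟩, AffinePoint.ext hx hy⟩
  have h := aeval_algHom_apply (FiniteField.frobeniusAlgHom F E) x C.f
  simp only [FiniteField.coe_frobeniusAlgHom] at h
  change (y ^ 2) ^ _ = (aeval x C.f) ^ _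
  rw [← h, hx, ← P.equation, ← hy]; ring

lemma frob_invol (P : C.AffinePoint E) : P.invol.frob = P.frob.invol :=
  AffinePoint.ext rfl (map_neg (FiniteField.frobeniusAlgHom F E) P.y)

end AffinePoint

lemma option_map_frob_injective :
    Function.Injective (Option.map (AffinePoint.frob : C.AffinePoint E → C.AffinePoint E)) :=
  Option.map_injective AffinePoint.frob_injective

lemma φ_apply_frob (D : C.Divisor E) (P : C.AffinePoint E) : φ D (some P.frob) = D (some P) :=
  Finsupp.mapDomain_apply option_map_frob_injective D (some P)

lemma φ_apply_none (D : C.Divisor E) : φ D none = D none :=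
  Finsupp.mapDomain_apply option_map_frob_injective D none

lemma φ_pow_eq_iterate (j : ℕ) (D : C.Divisor E) : (φ ^ j) D = φ^[j] D := by
  induction j generalizing D with
  | zero => rfl
  | succ j ih => rw [pow_succ, Function.iterate_succ_apply, ← ih]; rfl

lemma φ_pow_add_apply (a b : ℕ) (D : C.Divisor E) : (φ ^ (a + b)) D = (φ ^ a) ((φ ^ b) D) := by
  rw [pow_add]; rfl

lemma φ_pow_succ_apply (j : ℕ) (D : C.Divisor E) : (φ ^ (j + 1)) D = φ ((φ ^ j) D) := by
  rw [pow_succ']; rfl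

lemma φ_pow_mul_apply {n : ℕ} {D : C.Divisor E} (h : (φ ^ n) D = D) (k : ℕ) :
    (φ ^ (n * k)) D = D := by
  induction k with
  | zero => rfl
  | succ k ih => rw [Nat.mul_succ, φ_pow_add_apply, h, ih]

lemma φ_pow_comm (a b : ℕ) (D : C.Divisor E) : (φ ^ a) ((φ ^ b) D) = (φ ^ b) ((φ ^ a) D) := by
  rw [← φ_pow_add_apply, add_comm, φ_pow_add_apply]

lemma w_φ (D : C.Divisor E) : w (φ D) = φ (w D) := by
  simp only [w, φ, Finsupp.mapDomain.addMonoidHom_apply]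
  change Finsupp.mapDomain _ (Finsupp.mapDomain _ D) = Finsupp.mapDomain _ (Finsupp.mapDomain _ D)
  rw [← Finsupp.mapDomain_comp, ← Finsupp.mapDomain_comp]
  congr 1
  funext P
  rcases P with _ | P
  · rfl
  · simp [AffinePoint.frob_invol]

lemma w_φ_pow (j : ℕ) (D : C.Divisor E) : w ((φ ^ j) D) = (φ ^ j) (w D) := by
  induction j with
  | zero => rfl
  | succ j ih => rw [φ_pow_succ_apply, φ_pow_succ_apply, w_φ, ih]

lemma φ_single (P : C.Point E) (c : ℤ) :
    φ (Finsupp.single P c) = Finsupp.single (P.map AffinePoint.frob) c :=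
  Finsupp.mapDomain_single

lemma φ_ofPoints {r : ℕ} (P : Fin r → C.AffinePoint E) :
    φ (ofPoints P) = ofPoints fun i => (P i).frob := by
  simp only [ofPoints, map_sub, map_sum, φ_single, Option.map_some, Option.map_none]

lemma IsReduced.φ {D : C.Divisor E} (h : IsReduced D) : IsReduced (φ D) := by
  obtain ⟨r, P, hr, rfl, hP⟩ := h
  refine ⟨r, _, hr, φ_ofPoints P, fun i j hij he => hP i j hij ?_⟩
  rw [← AffinePoint.frob_invol] at he
  exact AffinePoint.frob_injective he

/-- On an algebraic extension of a finite field Frobenius is an automorphism, so `φ(D)` is the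
divisor of the function with conjugated coefficients. -/
lemma φ_mem_principal [Algebra.IsAlgebraic F E] [IsAlgClosed E] {D : C.Divisor E}
    (hD : D ∈ C.principal E) : φ D ∈ C.principal E := by
  induction hD using AddSubgroup.closure_induction with
  | zero => rw [map_zero]; exact zero_mem _
  | add x y _ _ hx hy => rw [map_add]; exact add_mem hx hy
  | neg x _ hx => rw [map_neg]; exact neg_mem hx
  | mem D h =>
    obtain ⟨p, q, h⟩ := h
    rw [hasDivisor_iff] at h
    obtain ⟨h0, h1, h2⟩ := h
    set σ := FiniteField.frobeniusAlgEquivOfAlgebraic F E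
    have hσ : ∀ P : C.AffinePoint E, P.conj σ.toAlgHom = P.frob := fun P => rfl
    have hinj : Function.Injective σ.toAlgHom.toRingHom := σ.injective
    refine AddSubgroup.subset_closure
      ⟨p.map σ.toAlgHom.toRingHom, q.map σ.toAlgHom.toRingHom, ?_⟩
    rw [hasDivisor_iff]
    refine ⟨?_, fun P => ?_, ?_⟩
    · rw [Ne, func_eq_zero] at h0 ⊢
      rwa [Polynomial.map_eq_zero_iff hinj, Polynomial.map_eq_zero_iff hinj]
    · obtain ⟨P, rfl⟩ := P.frob_surjective
      rw [φ_apply_frob, h1, ← conjRing_func, ← hσ, ord_conjRing σ h0]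
    · rw [φ_apply_none, h2]
      have hq := Polynomial.map_eq_zero_iff (p := q) hinj
      by_cases h : q = 0
      · simp only [poleOrder, natDegree_map_eq_of_injective hinj, if_pos h, if_pos (hq.mpr h)]
      · simp only [poleOrder, natDegree_map_eq_of_injective hinj, if_neg h, if_neg (mt hq.mp h)]

/-- As `w` is an involution commuting with `φ`, the period of `D` under `φ` divides both `n` and
`2c`, which are coprime. -/
lemma w_eq_self_of_eq_φ_pow {n c : ℕ} (hn : n.Prime) (hn2 : n ≠ 2) (hc : ¬ n ∣ c)
    {D : C.Divisor E} (h : (φ ^ n) D = D) (hw : w D = (φ ^ c) D) : φ D = D ∧ w D = D := by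
  have h2 : (φ ^ (c + c)) D = D := by
    rw [φ_pow_add_apply, ← hw, ← w_φ_pow, ← hw, w_w]
  have p1 : Function.IsPeriodicPt φ n D := by
    rw [Function.IsPeriodicPt, Function.IsFixedPt, ← φ_pow_eq_iterate, h]
  have p2 : Function.IsPeriodicPt φ (c + c) D := by
    rw [Function.IsPeriodicPt, Function.IsFixedPt, ← φ_pow_eq_iterate, h2]
  have p3 := p1.gcd p2
  have hg : n.gcd (c + c) = 1 := by
    rw [← Nat.coprime_iff_gcd_eq_one, hn.coprime_iff_not_dvd, ← two_mul, hn.dvd_mul]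
    rintro (h | h)
    · exact hn2 ((Nat.prime_dvd_prime_iff_eq hn Nat.prime_two).mp h)
    · exact hc h
  rw [hg] at p3
  refine ⟨p3, ?_⟩
  rw [hw, φ_pow_eq_iterate]
  exact Function.iterate_fixed p3 c

lemma w_ne_φ_pow {n : ℕ} (hn : n.Prime) (hn2 : n ≠ 2) {D : C.Divisor E} (h : (φ ^ n) D = D)
    (hD : D ≠ w D) (c : ℕ) : w D ≠ (φ ^ c) D := by
  intro hw
  by_cases hc : n ∣ c
  · obtain ⟨k, rfl⟩ := hc
    rw [φ_pow_mul_apply h] at hw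
    exact hD hw.symm
  · exact hD (w_eq_self_of_eq_φ_pow hn hn2 hc h hw).2.symm

/-- On divisors fixed by `φ^n`, the power `φ^((n-1)b)` inverts `φ^b` without negative exponents. -/
lemma φ_pow_cancel {n : ℕ} (hn : 0 < n) {D D' : C.Divisor E} (h : (φ ^ n) D = D) {b : ℕ}
    (hb : (φ ^ b) D = D') : D = (φ ^ ((n - 1) * b)) D' := by
  rw [← hb, ← φ_pow_add_apply, show (n - 1) * b + b = n * b by
    rw [← Nat.succ_mul, Nat.succ_eq_add_one, Nat.sub_add_cancel hn], φ_pow_mul_apply h]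

lemma Tr_apply (n : ℕ) (D : C.Divisor E) (P : C.Point E) :
    Tr n D P = ∑ j ∈ Finset.range n, (φ ^ j) D P := by
  change (∑ j ∈ Finset.range n, (φ ^ j) D) P = _
  rw [Finsupp.finsetSum_apply]

lemma Tr_φ_pow {n : ℕ} {D : C.Divisor E} (h : (φ ^ n) D = D) (j : ℕ) :
    Tr n ((φ ^ j) D) = Tr n D := by
  have key : ∀ D : C.Divisor E, (φ ^ n) D = D → Tr n (φ D) = Tr n D := by
    intro D h
    change ∑ j ∈ Finset.range n, (φ ^ j) (φ D) = ∑ j ∈ Finset.range n, (φ ^ j) D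
    have h1 := Finset.sum_range_succ (fun j => (φ ^ j) D) n
    rw [Finset.sum_range_succ', h, pow_zero] at h1
    exact add_right_cancel h1
  induction j with
  | zero => rfl
  | succ j ih => rw [φ_pow_succ_apply, key _ (by rw [φ_pow_comm, h]), ih]

lemma φ_pow_nonneg [IsAlgClosed E] {D : C.Divisor E} (h : AffineLE 0 D) (j : ℕ) :
    AffineLE 0 ((φ ^ j) D) := by
  induction j with
  | zero => exact h
  | succ j ih =>
    intro P
    obtain ⟨P, rfl⟩ := P.frob_surjective
    rw [φ_pow_succ_apply, φ_apply_frob]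
    exact ih P

lemma Tr_nonneg [IsAlgClosed E] {D : C.Divisor E} (h : AffineLE 0 D) (n : ℕ) :
    AffineLE 0 (Tr n D) := fun P => by
  rw [Tr_apply]
  exact Finset.sum_nonneg fun j _ => φ_pow_nonneg h j P

end Frobenius

/-! ### Prime divisors as irreducible graphs. -/

section PrimeDivisors

variable {F : Type*} [Field F] {C : HECurve F} {Ω : Type*} [Field Ω] [Algebra F Ω]
  {L : Type*} [Field L] [Algebra F L] [Algebra L Ω]

/-- The divisor of the zeros of `u` on the graph of `v`, where `u` is irreducible over `L` and
`[u, v]` satisfies the conditions on a Mumford representation. -/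
structure IsGraphDivisor (D : C.Divisor Ω) (u v : L[X]) : Prop where
  monic : u.Monic
  irreducible : Irreducible u
  degree_lt : v.degree < u.degree
  dvd : u ∣ v ^ 2 - C.f.map (algebraMap F L)
  apply_some : ∀ Q : C.AffinePoint Ω, D (some Q) =
    open Classical in if aeval Q.x u = 0 ∧ aeval Q.x v = Q.y then 1 else 0
  apply_none : D none = -u.natDegree

/-- Over a perfect field an irreducible `u` is separable, so the `X_i` are distinct and every point
occurs once. -/
lemma IsPrimeDivisor.isGraphDivisor [Fintype F] [PerfectField L] {n : ℕ} {D : C.Divisor Ω}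
    {u v : L[X]}
    (h : IsPrimeDivisor n D u v) : IsGraphDivisor D u v := by
  classical
  obtain ⟨-, -, ⟨r, P, rfl, -, hu, hdeg, hv, hdvd⟩, hirr⟩ := h
  have hsep : (∏ i, (X - Polynomial.C (P i).x)).Separable :=
    hu ▸ (PerfectField.separable_of_irreducible hirr).map
  have hinj : Function.Injective fun i => (P i).x := separable_prod_X_sub_C_iff.mp hsep
  have hmon : (u.map (algebraMap L Ω)).Monic := hu ▸ monic_prod_X_sub_C _ _
  refine ⟨(monic_map_iff).mp hmon, hirr, hdeg, hdvd, fun Q => ?_, ?_⟩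
  · rw [ofPoints_apply_some]
    have hroot : aeval Q.x u = 0 ↔ ∃ i, (P i).x = Q.x := by
      rw [← eval_map_algebraMap, hu, eval_prod, Finset.prod_eq_zero_iff]
      simp [sub_eq_zero, eq_comm]
    by_cases hQ : aeval Q.x u = 0 ∧ aeval Q.x v = Q.y
    · obtain ⟨i, hi⟩ := hroot.mp hQ.1
      have hPi : P i = Q := AffinePoint.ext hi (by rw [← hv i, hi, hQ.2])
      rw [if_pos hQ, Finset.sum_eq_single i, if_pos hPi]
      · intro j _ hj
        exact if_neg fun hjQ => hj (hinj (congrArg AffinePoint.x (hjQ.trans hPi.symm)))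
      · simp
    · rw [if_neg hQ]
      refine Finset.sum_eq_zero fun i _ => if_neg ?_
      rintro rfl
      exact hQ ⟨hroot.mpr ⟨i, rfl⟩, hv i⟩
  · rw [ofPoints_apply_none, ← natDegree_map (algebraMap L Ω), hu, natDegree_prod_of_monic]
    · simp
    · exact fun i _ => monic_X_sub_C _

namespace IsGraphDivisor

variable {D D' : C.Divisor Ω} {u v u' v' : L[X]}

lemma nonneg (h : IsGraphDivisor D u v) (Q : C.AffinePoint Ω) : 0 ≤ D (some Q) := by
  rw [h.apply_some]; split_ifs <;> norm_num

lemma affineLE {D : C.Divisor Ω} {u v : L[X]} (h : IsGraphDivisor D u v) :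
    AffineLE 0 D := fun P => h.nonneg P

lemma ne_zero_iff (h : IsGraphDivisor D u v) (Q : C.AffinePoint Ω) :
    D (some Q) ≠ 0 ↔ aeval Q.x u = 0 ∧ aeval Q.x v = Q.y := by
  rw [h.apply_some]; split_ifs with hQ <;> simp [hQ]

lemma eq_one (h : IsGraphDivisor D u v) {Q : C.AffinePoint Ω} (hQ : D (some Q) ≠ 0) :
    D (some Q) = 1 := by
  rw [h.apply_some, if_pos ((h.ne_zero_iff Q).mp hQ)]

lemma eq_minpoly (h : IsGraphDivisor D u v) {x : Ω} (hx : aeval x u = 0) : u = minpoly L x :=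
  minpoly.eq_of_irreducible_of_monic h.irreducible hx h.monic

/-- Two divisors supported on irreducible graphs are equal as soon as they share a point. -/
lemma eq_of_apply_ne_zero (h : IsGraphDivisor D u v) (h' : IsGraphDivisor D' u' v')
    {Q : C.AffinePoint Ω} (hQ : D (some Q) ≠ 0) (hQ' : D' (some Q) ≠ 0) : D = D' := by
  rw [h.ne_zero_iff] at hQ
  rw [h'.ne_zero_iff] at hQ'
  obtain rfl : u = u' := (h.eq_minpoly hQ.1).trans (h'.eq_minpoly hQ'.1).symm
  -- Both `u` and `u'` are the minimal polynomial of `x(Q)`; `v - v'` also vanishes there but has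
  -- smaller degree.
  have hdvd : u ∣ v - v' := by
    rw [h.eq_minpoly hQ.1]
    refine minpoly.dvd _ _ ?_
    rw [map_sub, hQ.2, hQ'.2, sub_self]
  obtain rfl : v = v' := by
    rw [← sub_eq_zero]
    by_contra hne
    exact not_dvd_of_degree_lt hne
      (lt_of_le_of_lt (degree_sub_le _ _) (max_lt h.degree_lt h'.degree_lt)) hdvd
  exact divisor_ext (fun P => by rw [h.apply_some, h'.apply_some])
    (by rw [h.apply_none, h'.apply_none])

lemma exists_apply_ne_zero [IsScalarTower F L Ω] [IsAlgClosed Ω] (h : IsGraphDivisor D u v) :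
    ∃ Q : C.AffinePoint Ω, D (some Q) ≠ 0 := by
  obtain ⟨x, hx⟩ := IsAlgClosed.exists_aeval_eq_zero Ω u h.irreducible.degree_pos.ne'
  have hy : (aeval x v) ^ 2 = aeval x C.f := by
    obtain ⟨c, hc⟩ := h.dvd
    have := congrArg (aeval x) hc
    rw [map_mul, hx, zero_mul, map_sub, map_pow, aeval_map_algebraMap, sub_eq_zero] at this
    exact this
  exact ⟨⟨x, aeval x v, hy⟩, (h.ne_zero_iff _).mpr ⟨hx, rfl⟩⟩

lemma w (h : IsGraphDivisor D u v) : IsGraphDivisor (w D) u (-v) where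
  monic := h.monic
  irreducible := h.irreducible
  degree_lt := by rw [degree_neg]; exact h.degree_lt
  dvd := by rw [neg_sq]; exact h.dvd
  apply_some Q := by
    rw [w_apply_some, h.apply_some]
    have : (aeval Q.invol.x u = 0 ∧ aeval Q.invol.x v = Q.invol.y) ↔
        (aeval Q.x u = 0 ∧ aeval Q.x (-v) = Q.y) := by
      simp [AffinePoint.invol, neg_eq_iff_eq_neg]
    by_cases h' : aeval Q.x u = 0 ∧ aeval Q.x (-v) = Q.y
    · rw [if_pos h', if_pos (this.mpr h')]
    · rw [if_neg h', if_neg (mt this.mp h')]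
  apply_none := by rw [w_apply_none, h.apply_none]

lemma aeval_frobenius_map [Fintype F] [IsScalarTower F L Ω] (p : L[X]) (x : Ω) :
    aeval (x ^ Fintype.card F) (p.map (FiniteField.frobeniusAlgHom F L).toRingHom) =
      (aeval x p) ^ Fintype.card F := by
  have h1 : (aeval x p) ^ Fintype.card F =
      (FiniteField.frobeniusAlgHom F Ω).toRingHom (eval₂ (algebraMap L Ω) x p) := rfl
  rw [h1, hom_eval₂, aeval_def, eval₂_map]
  congr 1
  ext a
  simp

lemma φ [Fintype F] [IsScalarTower F L Ω] [Finite L] [IsAlgClosed Ω]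
    (h : IsGraphDivisor D u v) :
    IsGraphDivisor (φ D) (u.map (FiniteField.frobeniusAlgHom F L).toRingHom)
      (v.map (FiniteField.frobeniusAlgHom F L).toRingHom) := by
  set σ := (FiniteField.frobeniusAlgHom F L).toRingHom with hσ
  have hinj : Function.Injective σ := σ.injective
  have hbij : Function.Bijective σ := Finite.injective_iff_bijective.mp hinj
  refine ⟨h.monic.map _, ?_, ?_, ?_, fun Q => ?_, ?_⟩
  · have := (MulEquiv.irreducible_iff (mapEquiv (RingEquiv.ofBijective σ hbij)) (x := u)).mpr
      h.irreducible
    exact this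
  · rw [degree_map_eq_of_injective hinj, degree_map_eq_of_injective hinj]; exact h.degree_lt
  · have h1 := Polynomial.map_dvd σ h.dvd
    have h2 : σ.comp (algebraMap F L) = algebraMap F L := by ext x; simp [hσ]
    rwa [Polynomial.map_sub, Polynomial.map_pow, Polynomial.map_map, h2] at h1
  · obtain ⟨Q, rfl⟩ := Q.frob_surjective
    rw [φ_apply_frob, h.apply_some]
    have h1 : aeval Q.frob.x (u.map σ) = 0 ↔ aeval Q.x u = 0 := by
      change aeval (Q.x ^ _) _ = 0 ↔ _
      rw [aeval_frobenius_map]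
      exact pow_eq_zero_iff Fintype.card_ne_zero
    have h2 : aeval Q.frob.x (v.map σ) = Q.frob.y ↔ aeval Q.x v = Q.y := by
      change aeval (Q.x ^ _) _ = Q.y ^ _ ↔ _
      rw [aeval_frobenius_map]
      exact pow_card_injective.eq_iff
    by_cases h' : aeval Q.x u = 0 ∧ aeval Q.x v = Q.y
    · rw [if_pos h', if_pos ⟨h1.mpr h'.1, h2.mpr h'.2⟩]
    · rw [if_neg h', if_neg fun h3 => h' ⟨h1.mp h3.1, h2.mp h3.2⟩]
  · rw [φ_apply_none, h.apply_none, natDegree_map_eq_of_injective hinj]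

lemma φ_pow [Fintype F] [IsScalarTower F L Ω] [Finite L] [IsAlgClosed Ω]
    (h : IsGraphDivisor D u v) (j : ℕ) :
    IsGraphDivisor ((HECurve.φ ^ j) D)
      (u.map (FiniteField.frobeniusAlgHom F L ^ j : L →ₐ[F] L).toRingHom)
      (v.map (FiniteField.frobeniusAlgHom F L ^ j : L →ₐ[F] L).toRingHom) := by
  induction j with
  | zero =>
    have e : (FiniteField.frobeniusAlgHom F L ^ 0 : L →ₐ[F] L).toRingHom = RingHom.id L := rfl
    rw [e, Polynomial.map_id, Polynomial.map_id]
    exact h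
  | succ j ih =>
    have e : (FiniteField.frobeniusAlgHom F L ^ (j + 1) : L →ₐ[F] L).toRingHom =
        (FiniteField.frobeniusAlgHom F L).toRingHom.comp
          (FiniteField.frobeniusAlgHom F L ^ j : L →ₐ[F] L).toRingHom := by
      rw [pow_succ']; rfl
    rw [e, ← Polynomial.map_map, ← Polynomial.map_map, φ_pow_succ_apply]
    exact ih.φ

/-- The function `u` has the affine divisor `D + w(D)`. -/
lemma ord_eq [IsScalarTower F L Ω] [PerfectField L] (h : IsGraphDivisor D u v)
    (P : C.AffinePoint Ω) :
    (P.ord (C.func (u.map (algebraMap L Ω)) 0) : ℤ) = D (some P) + HECurve.w D (some P) := by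
  have hne : u.map (algebraMap L Ω) ≠ 0 := (h.monic.map _).ne_zero
  have hsep : (u.map (algebraMap L Ω)).Separable :=
    (PerfectField.separable_of_irreducible h.irreducible).map
  by_cases hx : aeval P.x u = 0
  · have hroot : (u.map (algebraMap L Ω)).IsRoot P.x := by
      rw [IsRoot, eval_map_algebraMap, hx]
    have hm : (u.map (algebraMap L Ω)).rootMultiplicity P.x = 1 :=
      le_antisymm (rootMultiplicity_le_one_of_separable hsep _)
        ((rootMultiplicity_pos hne).mpr hroot)
    have hy : P.y = aeval P.x v ∨ P.y = -aeval P.x v := by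
      obtain ⟨c, hc⟩ := h.dvd
      have := congrArg (aeval P.x) hc
      rw [map_mul, hx, zero_mul, map_sub, map_pow, aeval_map_algebraMap, sub_eq_zero,
        ← P.equation] at this
      exact (sq_eq_sq_iff_eq_or_eq_neg.mp this.symm)
    rw [P.ord_func_poly hne, hm, mul_one]
    have hc : D (some P) ≠ 0 ↔ aeval P.x v = P.y := by simp [h.ne_zero_iff, hx]
    have hw : HECurve.w D (some P) ≠ 0 ↔ -aeval P.x v = P.y := by simp [h.w.ne_zero_iff, hx]
    -- At a ramified point both `D` and `w(D)` contain `P`, which matches the order `2`; otherwise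
    -- exactly one does.
    by_cases hy0 : P.y = 0
    · have h0 : aeval P.x v = 0 := by rcases hy with hy | hy <;> simpa [hy0] using hy.symm
      rw [h.eq_one (hc.mpr (h0.trans hy0.symm)),
        h.w.eq_one (hw.mpr (by rw [h0, hy0, neg_zero])), AffinePoint.ram, if_pos hy0]
      norm_num
    · have hneg : -P.y ≠ P.y := fun h => hy0 (P.eq_invol_iff.mp (AffinePoint.ext rfl h.symm))
      rw [AffinePoint.ram, if_neg hy0]
      rcases hy with hy | hy
      · rw [h.eq_one (hc.mpr hy.symm), not_not.mp (mt hw.mp (by rwa [← hy]))]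
        norm_num
      · have hv : aeval P.x v = -P.y := by rw [hy, neg_neg]
        rw [h.w.eq_one (hw.mpr hy.symm), not_not.mp (mt hc.mp (by rwa [hv]))]
        norm_num
  · rw [P.ord_of_eval_ne_zero (by rwa [eval_map_algebraMap]),
      not_not.mp (mt (h.ne_zero_iff P).mp fun h' => hx h'.1),
      not_not.mp (mt (h.w.ne_zero_iff P).mp fun h' => hx h'.1)]
    rfl

end IsGraphDivisor

end PrimeDivisors

/-! ### Equality of classes, and uniqueness of exact exponents. -/

section General

variable {F : Type*} [Field F] {C : HECurve F} {Ω : Type*} [Field Ω] [Algebra F Ω]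

lemma cls_eq_cls_iff {D D' : C.Div0 Ω} :
    cls D = cls D' ↔ -(D : C.Divisor Ω) + D' ∈ C.principal Ω :=
  QuotientAddGroup.eq (s := (C.principal Ω).addSubgroupOf (C.Div0 Ω)) (a := D) (b := D')

lemma cls_eq_zero_iff {D : C.Div0 Ω} : cls D = 0 ↔ (D : C.Divisor Ω) ∈ C.principal Ω :=
  QuotientAddGroup.eq_zero_iff (N := (C.principal Ω).addSubgroupOf (C.Div0 Ω)) D

lemma exact_unique {T : C.Divisor Ω} {A : C.AffinePoint Ω → ℤ} (hA : ∀ P, 0 ≤ A P) {s s' : ℕ}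
    (h : ∀ P, (s : ℤ) * A P ≤ T (some P)) (h' : ¬ ∀ P, ((s + 1 : ℕ) : ℤ) * A P ≤ T (some P))
    (k : ∀ P, (s' : ℤ) * A P ≤ T (some P))
    (k' : ¬ ∀ P, ((s' + 1 : ℕ) : ℤ) * A P ≤ T (some P)) : s = s' := by
  rcases lt_trichotomy s s' with hlt | rfl | hlt
  · refine absurd (fun P => le_trans ?_ (k P)) h'
    exact mul_le_mul_of_nonneg_right (by exact_mod_cast hlt) (hA P)
  · rfl
  · refine absurd (fun P => le_trans ?_ (h P)) k'
    exact mul_le_mul_of_nonneg_right (by exact_mod_cast hlt) (hA P)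

end General

/-! ### Supports of traces, and rational 2-torsion. -/

section FrobeniusAction

variable {F : Type*} [Field F] [Fintype F] {C : HECurve F} {Ω : Type*} [Field Ω] [Algebra F Ω]

lemma exists_φ_pow_apply_ne_zero {D : C.Divisor Ω} {n : ℕ} {P : C.AffinePoint Ω}
    (hP : Tr n D (some P) ≠ 0) : ∃ j < n, (φ ^ j) D (some P) ≠ 0 := by
  rw [Tr_apply] at hP
  obtain ⟨j, hj, hne⟩ := Finset.exists_ne_zero_of_sum_ne_zero hP
  exact ⟨j, Finset.mem_range.mp hj, hne⟩

lemma Tr_sum_apply {n t : ℕ} {Dp : Fin t → C.Div0 Ω} (P : C.AffinePoint Ω) :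
    Tr n ((∑ k, Dp k : C.Div0 Ω) : C.Divisor Ω) (some P) =
      ∑ a ∈ Finset.range n ×ˢ (Finset.univ : Finset (Fin t)),
        (φ ^ a.1) (Dp a.2 : C.Divisor Ω) (some P) := by
  rw [Finset.sum_product, Tr_apply]
  refine Finset.sum_congr rfl fun j _ => ?_
  rw [AddSubgroup.val_finsetSum, map_sum, Finsupp.finsetSum_apply]

/-- A reduced divisor whose class is a rational 2-torsion class is itself rational and fixed by
the involution. -/
lemma IsReduced.fixed_of_two_torsion [Algebra.IsAlgebraic F Ω] [IsAlgClosed Ω]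
    {D : C.Div0 Ω} (h : IsReduced (D : C.Divisor Ω))
    (h1 : cls D ∈ C.picRational Ω 1) (h2 : 2 • cls D = 0) :
    HECurve.φ (D : C.Divisor Ω) = D ∧ HECurve.w (D : C.Divisor Ω) = D := by
  constructor
  · obtain ⟨D', hD', he⟩ := h1
    have hr : HECurve.φ (D' : C.Divisor Ω) = D' := hD'
    have hp : -(D' : C.Divisor Ω) + D ∈ C.principal Ω := cls_eq_cls_iff.mp he
    -- From `D ∼ D'` with `D'` rational it follows that `φ(D) ∼ D`, and both are reduced.
    refine h.φ.eq_of_sub_mem_principal h ?_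
    have hq := sub_mem (φ_mem_principal hp) hp
    rw [map_add, map_neg, hr] at hq
    convert hq using 1
    abel
  · have h3 : ((2 • D : C.Div0 Ω) : C.Divisor Ω) ∈ C.principal Ω := by
      have : cls (2 • D) = 0 := by rw [map_nsmul, h2]
      exact cls_eq_zero_iff.mp this
    -- Subtracting `2D ∼ 0` from `D + w(D) ∼ 0` gives `w(D) ∼ D`.
    refine h.w.eq_of_sub_mem_principal h ?_
    have hq := sub_mem h.add_w_mem_principal h3
    convert hq using 1
    rw [AddSubgroup.coe_nsmul, two_nsmul]
    abel

lemma IsReduced.two_torsion_of_fixed {D : C.Div0 Ω} (h : IsReduced (D : C.Divisor Ω))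
    (h1 : HECurve.φ (D : C.Divisor Ω) = D) (h2 : HECurve.w (D : C.Divisor Ω) = D) :
    cls D ∈ C.picRational Ω 1 ∧ 2 • cls D = 0 := by
  refine ⟨⟨D, h1, rfl⟩, ?_⟩
  rw [← map_nsmul]
  refine cls_eq_zero_iff.mpr ?_
  have h3 := h.add_w_mem_principal
  rw [h2, ← two_nsmul] at h3
  exact h3

lemma apply_le_Tr_apply [IsAlgClosed Ω] {D : C.Divisor Ω} (h : AffineLE 0 D) {n : ℕ} (hn : 0 < n)
    (P : C.AffinePoint Ω) : D (some P) ≤ Tr n D (some P) := by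
  rw [Tr_apply]
  exact Finset.single_le_sum (f := fun j => (φ ^ j) D (some P))
    (fun j _ => φ_pow_nonneg h j P) (Finset.mem_range.mpr hn)

end FrobeniusAction

/-! ### The norm of `u` and conjugacy of prime divisors. -/

variable {F : Type*} [Field F] [Fintype F] {C : HECurve F} {Ω : Type*} [Field Ω] [Algebra F Ω]
  {L : Type*} [Field L] [Algebra F L] [Algebra L Ω] [IsScalarTower F L Ω] [Finite L]
  [IsAlgClosed Ω]

/-- The `j`-th conjugate of `u` belongs to `φ^j(D)`, so it contributes `φ^j(D) + φ^j(w(D))`. -/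
lemma IsGraphDivisor.ord_polyNorm {D : C.Divisor Ω} {u v : L[X]} (h : IsGraphDivisor D u v)
    (n : ℕ) (P : C.AffinePoint Ω) : polyNorm F n u ≠ 0 ∧
    (P.ord (C.func ((polyNorm F n u).map (algebraMap L Ω)) 0) : ℤ) =
      Tr n D (some P) + Tr n (HECurve.w D) (some P) := by
  induction n with
  | zero => simp [polyNorm, Tr, func_one, AffinePoint.ord_one]
  | succ n ih =>
    obtain ⟨ih0, ih⟩ := ih
    have hj := h.φ_pow n
    have e : polyNorm F (n + 1) u = polyNorm F n u *
        u.map (FiniteField.frobeniusAlgHom F L ^ n : L →ₐ[F] L).toRingHom :=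
      Finset.prod_range_succ _ _
    have hne := hj.monic.ne_zero
    have hinj := (algebraMap L Ω).injective
    refine ⟨e ▸ mul_ne_zero ih0 hne, ?_⟩
    have e2 : C.func ((polyNorm F (n + 1) u).map (algebraMap L Ω)) 0 =
        C.func ((polyNorm F n u).map (algebraMap L Ω)) 0 *
        C.func ((u.map (FiniteField.frobeniusAlgHom F L ^ n : L →ₐ[F] L).toRingHom).map
          (algebraMap L Ω)) 0 := by
      rw [func_mul_left, e, Polynomial.map_mul, mul_zero]
    rw [e2, P.ord_mul, Nat.cast_add, ih, hj.ord_eq, w_φ_pow]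
    · simp only [Tr_apply, Finset.sum_range_succ]; ring
    · rw [Ne, func_eq_zero, Polynomial.map_eq_zero_iff hinj]; tauto
    · rw [Ne, func_eq_zero, Polynomial.map_eq_zero_iff hinj]; tauto

/-- Divisibility is componentwise in `L[x]` and so unchanged by extension to `Ω`, where orders
decide it. -/
lemma polyNorm_pow_dvd_iff {D T : C.Divisor Ω} {u v : L[X]} (h : IsGraphDivisor D u v)
    {h₁ h₂ : F[X]} (hT : C.HasDivisor (h₁.map (algebraMap F Ω)) (h₂.map (algebraMap F Ω)) T)
    (n s : ℕ) :
    C.func (polyNorm F n u ^ s) 0 ∣ C.func (h₁.map (algebraMap F L)) (h₂.map (algebraMap F L)) ↔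
      ∀ P : C.AffinePoint Ω,
        (s : ℤ) * (Tr n D (some P) + Tr n (w D) (some P)) ≤ T (some P) := by
  obtain ⟨hne, hord, -⟩ := hasDivisor_iff.mp hT
  obtain ⟨Q, -⟩ := h.exists_apply_ne_zero
  have hN := (h.ord_polyNorm n Q).1
  have hN' : (polyNorm F n u).map (algebraMap L Ω) ≠ 0 :=
    (Polynomial.map_ne_zero_iff (algebraMap L Ω).injective).mpr hN
  have hmap : ∀ p : F[X], p.map (algebraMap F Ω) = (p.map (algebraMap F L)).map (algebraMap L Ω) :=
    fun p => by rw [Polynomial.map_map, ← IsScalarTower.algebraMap_eq]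
  rw [func_dvd_iff, ← Polynomial.map_dvd_map' (algebraMap L Ω),
    ← Polynomial.map_dvd_map' (algebraMap L Ω), ← hmap, ← hmap, ← C.func_dvd_iff,
    Polynomial.map_pow, func_dvd_iff_ord_le (pow_ne_zero _ hN') hne]
  refine forall_congr' fun P => ?_
  rw [hord, func_pow, P.ord_pow (by rw [Ne, func_eq_zero]; tauto), ← (h.ord_polyNorm n P).2]
  exact_mod_cast Iff.rfl

/-- If the traces of two irreducible divisors share a point, then the divisors are conjugate. -/
lemma IsGraphDivisor.exists_eq_φ_pow {D D' : C.Divisor Ω} {u v u' v' : L[X]}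
    (h : IsGraphDivisor D u v) (h' : IsGraphDivisor D' u' v') {n : ℕ} (hn : 0 < n)
    (hD : (HECurve.φ ^ n) D = D) {P : C.AffinePoint Ω} (hP : Tr n D (some P) ≠ 0)
    (hP' : Tr n D' (some P) ≠ 0) : ∃ c, D = (HECurve.φ ^ c) D' := by
  obtain ⟨a, -, ha⟩ := exists_φ_pow_apply_ne_zero hP
  obtain ⟨b, -, hb⟩ := exists_φ_pow_apply_ne_zero hP'
  have e := (h.φ_pow a).eq_of_apply_ne_zero (h'.φ_pow b) ha hb
  have := φ_pow_cancel hn hD e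
  exact ⟨(n - 1) * a + b, by rw [φ_pow_add_apply]; exact this⟩

/-! ### The exact exponent of the norm. -/

section Exact

variable {D T : C.Divisor Ω} {u v : L[X]} {n : ℕ}

/-- The part of an effective divisor at an orbit determines the exact power of the norm. -/
lemma exact_of_decomposition (hn : n.Prime) (hn2 : n ≠ 2) (h : IsGraphDivisor D u v)
    (hD : (φ ^ n) D = D) (hw : D ≠ w D) {m l : ℕ} {G : C.Divisor Ω} (hG : AffineLE 0 G)
    (hG1 : ¬ AffineLE (Tr n D) (Tr n G)) (hG2 : ¬ AffineLE (Tr n (w D)) (Tr n G))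
    (hT : T = m • Tr n D + l • Tr n (w D) + Tr n G) :
    (∀ P : C.AffinePoint Ω,
      ((min l m : ℕ) : ℤ) * (Tr n D (some P) + Tr n (w D) (some P)) ≤ T (some P)) ∧
    ¬ (∀ P : C.AffinePoint Ω,
      ((min l m + 1 : ℕ) : ℤ) * (Tr n D (some P) + Tr n (w D) (some P)) ≤ T (some P)) := by
  have hTP : ∀ P : C.AffinePoint Ω, T (some P) =
      m * Tr n D (some P) + l * Tr n (w D) (some P) + Tr n G (some P) := by
    intro P; rw [hT]; simp
  have nA : ∀ P : C.AffinePoint Ω, 0 ≤ Tr n D (some P) := Tr_nonneg h.affineLE n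
  have nB : ∀ P : C.AffinePoint Ω, 0 ≤ Tr n (w D) (some P) := Tr_nonneg h.w.affineLE n
  have nG : ∀ P : C.AffinePoint Ω, 0 ≤ Tr n G (some P) := Tr_nonneg hG n
  -- A common point would make `w(D)` a Frobenius conjugate of `D`.
  have hdisj : ∀ P : C.AffinePoint Ω, Tr n D (some P) = 0 ∨ Tr n (w D) (some P) = 0 := by
    intro P
    by_contra! hP
    obtain ⟨c, hc⟩ := h.w.exists_eq_φ_pow h hn.pos (by rw [← w_φ_pow, hD]) hP.2 hP.1
    exact w_ne_φ_pow hn hn2 hD hw c hc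
  constructor
  · intro P
    have h1 : ((min l m : ℕ) : ℤ) ≤ m := by exact_mod_cast min_le_right l m
    have h2 : ((min l m : ℕ) : ℤ) ≤ l := by exact_mod_cast min_le_left l m
    rw [hTP, mul_add]
    have h3 := mul_le_mul_of_nonneg_right h1 (nA P)
    have h4 := mul_le_mul_of_nonneg_right h2 (nB P)
    have := nG P
    linarith
  · intro hle
    -- If `m ≤ l`, exponent `m + 1` forces `Tr(D) ≤ Tr(G)`: on the support of `Tr(D)` the trace of
    -- `w(D)` vanishes, and `m Tr(D)` cancels. The other case is symmetric.
    rcases le_total m l with hml | hml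
    · rw [min_eq_right hml] at hle
      refine hG1 fun P => ?_
      have h1 := hle P
      rw [hTP] at h1
      push_cast at h1
      rcases hdisj P with h0 | h0
      · rw [h0]; exact nG P
      · rw [h0] at h1; linarith
    · rw [min_eq_left hml] at hle
      refine hG2 fun P => ?_
      have h1 := hle P
      rw [hTP] at h1
      push_cast at h1
      rcases hdisj P with h0 | h0
      · rw [h0] at h1; linarith
      · rw [h0]; exact nG P

end Exact

/-! ### Sums of prime divisors: decomposition and the divisibility criterion. -/

section Sum

variable {n t : ℕ} {Dp : Fin t → C.Div0 Ω} {u v : Fin t → L[X]}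

/-- Splitting off the conjugates of `D_i` and of `w(D_i)` from a sum of irreducible divisors. -/
lemma exists_decomposition (hn : n.Prime) (hn2 : n ≠ 2)
    (hp : ∀ k, IsGraphDivisor (Dp k : C.Divisor Ω) (u k) (v k))
    (hr : ∀ k, (φ ^ n) (Dp k : C.Divisor Ω) = Dp k) (i : Fin t)
    (hw : (Dp i : C.Divisor Ω) ≠ w (Dp i : C.Divisor Ω)) :
    ∃ m l : ℕ, ∃ G : C.Div0 Ω, (G : C.Divisor Ω) ∈ C.rationalDiv Ω n ∧
      AffineLE 0 (G : C.Divisor Ω) ∧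
      ¬ AffineLE (Tr n (Dp i : C.Divisor Ω)) (Tr n (G : C.Divisor Ω)) ∧
      ¬ AffineLE (Tr n (w (Dp i : C.Divisor Ω))) (Tr n (G : C.Divisor Ω)) ∧
      Tr n ((∑ k, Dp k : C.Div0 Ω) : C.Divisor Ω) =
        m • Tr n (Dp i : C.Divisor Ω) + l • Tr n (w (Dp i : C.Divisor Ω)) +
          Tr n (G : C.Divisor Ω) := by
  classical
  have hrw : (φ ^ n) (w (Dp i : C.Divisor Ω)) = w (Dp i : C.Divisor Ω) := by
    rw [← w_φ_pow, hr i]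
  set A : Finset (Fin t) := {k | ∃ c, (Dp k : C.Divisor Ω) = (φ ^ c) (Dp i : C.Divisor Ω)} with hA
  set B : Finset (Fin t) := {k | ∃ c, (Dp k : C.Divisor Ω) = (φ ^ c) (w (Dp i : C.Divisor Ω))}
    with hB
  have hAB : Disjoint A B := by
    rw [Finset.disjoint_left]
    intro k hk hk'
    obtain ⟨a, ha⟩ := (Finset.mem_filter.mp hk).2
    obtain ⟨b, hb⟩ := (Finset.mem_filter.mp hk').2
    have := φ_pow_cancel hn.pos hrw (hb.symm.trans ha)
    rw [← φ_pow_add_apply] at this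
    exact w_ne_φ_pow hn hn2 (hr i) hw _ this
  set S : Finset (Fin t) := (A ∪ B)ᶜ with hS
  have hGc : ((∑ k ∈ S, Dp k : C.Div0 Ω) : C.Divisor Ω) = ∑ k ∈ S, (Dp k : C.Divisor Ω) :=
    AddSubgroup.val_finsetSum _ _ _
  have hTr : ∀ s : Finset (Fin t), ∀ P : C.AffinePoint Ω,
      Tr n (∑ k ∈ s, (Dp k : C.Divisor Ω)) (some P) =
        ∑ k ∈ s, Tr n (Dp k : C.Divisor Ω) (some P) := by
    intro s P; rw [map_sum, Finsupp.finsetSum_apply]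
  -- Conjugates have equal traces, so the multiplicities count the components conjugate to `D_i` and
  -- to `w(D_i)`; `G` collects the rest.
  refine ⟨A.card, B.card, ∑ k ∈ S, Dp k, ?_, ?_, ?_, ?_, ?_⟩
  · refine AddSubgroup.mem_carrier.mp ?_
    rw [hGc]
    exact AddSubgroup.sum_mem _ fun k _ => hr k
  · intro P
    rw [hGc, Finsupp.finsetSum_apply]
    exact Finset.sum_nonneg fun k _ => (hp k).nonneg P
  · obtain ⟨P, hP⟩ := (hp i).exists_apply_ne_zero
    have h1 := apply_le_Tr_apply (hp i).affineLE hn.pos P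
    rw [(hp i).eq_one hP] at h1
    intro hle
    have h2 := hle P
    -- `Tr(D_i)` is positive at `P`, but a component of `G` whose trace meets `P` would be conjugate
    -- to `D_i`.
    rw [hGc, hTr, Finset.sum_eq_zero] at h2
    · omega
    · intro k hk
      by_contra hne
      obtain ⟨c, hc⟩ := (hp k).exists_eq_φ_pow (hp i) hn.pos (hr k) hne (by omega)
      rw [hS, Finset.mem_compl, Finset.mem_union] at hk
      exact hk (Or.inl (Finset.mem_filter.mpr ⟨Finset.mem_univ _, c, hc⟩))
  · obtain ⟨P, hP⟩ := (hp i).w.exists_apply_ne_zero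
    have h1 := apply_le_Tr_apply (hp i).w.affineLE hn.pos P
    rw [(hp i).w.eq_one hP] at h1
    intro hle
    have h2 := hle P
    rw [hGc, hTr, Finset.sum_eq_zero] at h2
    · omega
    · intro k hk
      by_contra hne
      obtain ⟨c, hc⟩ := (hp k).exists_eq_φ_pow (hp i).w hn.pos (hr k) hne (by omega)
      rw [hS, Finset.mem_compl, Finset.mem_union] at hk
      exact hk (Or.inr (Finset.mem_filter.mpr ⟨Finset.mem_univ _, c, hc⟩))
  · rw [hGc, AddSubgroup.val_finsetSum, map_sum, map_sum,
      ← Finset.sum_add_sum_compl (A ∪ B), Finset.sum_union hAB]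
    congr 2
    · rw [← Finset.sum_const]
      refine Finset.sum_congr rfl fun k hk => ?_
      obtain ⟨c, hc⟩ := (Finset.mem_filter.mp hk).2
      rw [hc, Tr_φ_pow (hr i)]
    · rw [← Finset.sum_const]
      refine Finset.sum_congr rfl fun k hk => ?_
      obtain ⟨c, hc⟩ := (Finset.mem_filter.mp hk).2
      rw [hc, Tr_φ_pow hrw]

/-- `u_i ∣ h₂` if and only if `w(D_i)` is a conjugate of some `D_k`, other than `D_i` itself. -/
lemma dvd_iff_exists_w_eq (hn : 0 < n)
    (hp : ∀ k, IsGraphDivisor (Dp k : C.Divisor Ω) (u k) (v k)) {h₁ h₂ : F[X]}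
    (hT : C.HasDivisor (h₁.map (algebraMap F Ω)) (h₂.map (algebraMap F Ω))
      (Tr n ((∑ k, Dp k : C.Div0 Ω) : C.Divisor Ω))) (i : Fin t) :
    u i ∣ h₂.map (algebraMap F L) ↔
      ∃ j < n, ∃ k, (j, k) ≠ (0, i) ∧
        w (Dp i : C.Divisor Ω) = (φ ^ j) (Dp k : C.Divisor Ω) := by
  classical
  obtain ⟨hne, hord, -⟩ := hasDivisor_iff.mp hT
  obtain ⟨P, hP⟩ := (hp i).exists_apply_ne_zero
  have hP1 := (hp i).eq_one hP
  have hwP : w (Dp i : C.Divisor Ω) (some P.invol) = 1 := by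
    rw [w_apply_some, P.invol_invol, hP1]
  have nonneg : ∀ (Q : C.AffinePoint Ω) (a : ℕ × Fin t),
      0 ≤ (φ ^ a.1) (Dp a.2 : C.Divisor Ω) (some Q) :=
    fun Q a => ((hp a.2).φ_pow a.1).nonneg Q
  have hmem : ((0, i) : ℕ × Fin t) ∈ Finset.range n ×ˢ (Finset.univ : Finset (Fin t)) := by
    simp [hn]
  have hordP : 1 ≤ P.ord (C.func (h₁.map (algebraMap F Ω)) (h₂.map (algebraMap F Ω))) := by
    have h1 := hord P
    rw [Tr_sum_apply] at h1
    have h2 := Finset.single_le_sum (f := fun a : ℕ × Fin t =>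
      (φ ^ a.1) (Dp a.2 : C.Divisor Ω) (some P)) (fun a _ => nonneg P a) hmem
    simp only [pow_zero] at h2
    change (Dp i : C.Divisor Ω) (some P) ≤ _ at h2
    omega
  have hev := (P.ord_pos_iff hne).mp hordP
  rw [AffinePoint.mem_maxIdeal] at hev
  have hu := ((hp i).ne_zero_iff P).mp hP
  have hmap : h₂.map (algebraMap F Ω) = (h₂.map (algebraMap F L)).map (algebraMap L Ω) := by
    rw [Polynomial.map_map, ← IsScalarTower.algebraMap_eq]
  have h1 : u i ∣ h₂.map (algebraMap F L) ↔ (h₂.map (algebraMap F Ω)).eval P.x = 0 := by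
    rw [(hp i).eq_minpoly hu.1, minpoly.dvd_iff, hmap, eval_map_algebraMap]
  -- As `h_D` vanishes at `P`, vanishing of `h₂` at `x(P)` forces that of `h₁`.
  have h2 : (h₂.map (algebraMap F Ω)).eval P.x = 0 ↔
      (P.ram ≤ P.ord (C.func (h₁.map (algebraMap F Ω)) (h₂.map (algebraMap F Ω))) ∧
        P.ram ≤ P.invol.ord (C.func (h₁.map (algebraMap F Ω)) (h₂.map (algebraMap F Ω)))) := by
    rw [P.ord_X_sub_C_le_iff hne]
    refine ⟨fun h => ⟨?_, h⟩, And.right⟩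
    rwa [h, mul_zero, add_zero] at hev
  rw [h1, h2]
  have hordw := hord P.invol
  rw [Tr_sum_apply] at hordw
  -- At a fixed point order `2` is required and the pair `(0, i)` supplies only `1`, so a second
  -- pair is needed; hence the exclusion of `(0, i)`.
  by_cases hfix : P = P.invol
  · have hy := P.eq_invol_iff.mp hfix
    rw [← hfix] at hordw hwP ⊢
    rw [and_self, AffinePoint.ram, if_pos hy]
    rw [← Finset.add_sum_erase _ _ hmem] at hordw
    change (Dp i : C.Divisor Ω) (some P) + _ = _ at hordw
    rw [hP1] at hordw
    constructor
    · intro hle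
      have hne0 : ∑ a ∈ (Finset.range n ×ˢ (Finset.univ : Finset (Fin t))).erase (0, i),
          (φ ^ a.1) (Dp a.2 : C.Divisor Ω) (some P) ≠ 0 := by omega
      obtain ⟨⟨j, k⟩, hjk, hne'⟩ := Finset.exists_ne_zero_of_sum_ne_zero hne0
      rw [Finset.mem_erase, Finset.mem_product, Finset.mem_range] at hjk
      exact ⟨j, hjk.2.1, k, hjk.1, (hp i).w.eq_of_apply_ne_zero ((hp k).φ_pow j)
        (by rw [hwP]; exact one_ne_zero) hne'⟩
    · rintro ⟨j, hj, k, hjk, he⟩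
      have h3 := Finset.single_le_sum (f := fun a : ℕ × Fin t =>
        (φ ^ a.1) (Dp a.2 : C.Divisor Ω) (some P)) (fun a _ => nonneg P a)
        (show (j, k) ∈ (Finset.range n ×ˢ (Finset.univ : Finset (Fin t))).erase (0, i) by
          simp [hj]; simpa using hjk)
      dsimp only at h3
      rw [← he, hwP] at h3
      omega
  · have hy := mt P.eq_invol_iff.mpr hfix
    rw [AffinePoint.ram, if_neg hy]
    constructor
    · rintro ⟨-, hle⟩
      have hne0 : ∑ a ∈ Finset.range n ×ˢ (Finset.univ : Finset (Fin t)),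
          (φ ^ a.1) (Dp a.2 : C.Divisor Ω) (some P.invol) ≠ 0 := by omega
      obtain ⟨⟨j, k⟩, hjk, hne'⟩ := Finset.exists_ne_zero_of_sum_ne_zero hne0
      rw [Finset.mem_product, Finset.mem_range] at hjk
      refine ⟨j, hjk.1, k, ?_, (hp i).w.eq_of_apply_ne_zero ((hp k).φ_pow j)
        (by rw [hwP]; exact one_ne_zero) hne'⟩
      -- For the pair `(0, i)`, both `P` and `w(P)` would lie on the graph of `v_i` over the same
      -- `x`, hence coincide.
      rintro h0
      obtain ⟨rfl, rfl⟩ := Prod.mk.inj h0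
      have h4 := ((hp k).ne_zero_iff P.invol).mp hne'
      exact hfix (AffinePoint.ext rfl (hu.2.symm.trans h4.2))
    · rintro ⟨j, hj, k, -, he⟩
      refine ⟨hordP, ?_⟩
      have h3 := Finset.single_le_sum (f := fun a : ℕ × Fin t =>
        (φ ^ a.1) (Dp a.2 : C.Divisor Ω) (some P.invol)) (fun a _ => nonneg P.invol a)
        (show (j, k) ∈ Finset.range n ×ˢ (Finset.univ : Finset (Fin t)) by simp [hj])
      dsimp only at h3
      rw [← he, hwP] at h3
      omega

end Sum

end HECurve

end

theorem mainTheorem3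
    {F L Ω : Type*} [Field F] [Fintype F] [Field L] [Field Ω]
    [Algebra F L] [Algebra F Ω] [Algebra L Ω] [IsScalarTower F L Ω] [IsAlgClosure F Ω]
    (C : HECurve F) (n : ℕ) (hn : n.Prime) (hL : Module.finrank F L = n)
    (D : C.Div0 Ω) (hDred : HECurve.IsReduced (D : C.Divisor Ω))
    (hDT : HECurve.cls D ∈ C.traceZero Ω n)
    (h₁ h₂ : F[X])
    (hdiv : C.HasDivisor (h₁.map (algebraMap F Ω)) (h₂.map (algebraMap F Ω))
      (HECurve.Tr n (D : C.Divisor Ω)))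
    (t : ℕ) (Dp : Fin t → C.Div0 Ω) (u v : Fin t → L[X])
    (hprime : ∀ i, HECurve.IsPrimeDivisor n (Dp i : C.Divisor Ω) (u i) (v i))
    (hsum : D = ∑ i, Dp i) :
    -- (i)
    (∀ i, u i ∣ h₂.map (algebraMap F L) ↔
      ∃ j < n, ∃ k, (j, k) ≠ (0, i) ∧
        HECurve.w (Dp i : C.Divisor Ω) = (HECurve.φ ^ j) (Dp k : C.Divisor Ω)) ∧
    -- (ii)
    (n ≠ 2 → ∀ i,
      ((∃ j < n, j ≠ 0 ∧
          HECurve.w (Dp i : C.Divisor Ω) = (HECurve.φ ^ j) (Dp i : C.Divisor Ω)) ↔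
        HECurve.cls (Dp i) ∈ C.picRational Ω 1 ∧ 2 • HECurve.cls (Dp i) = 0)) ∧
    -- (iii)
    (n ≠ 2 → ∀ i, (Dp i : C.Divisor Ω) ≠ HECurve.w (Dp i : C.Divisor Ω) → ∀ s : ℕ,
      ((∃ m l : ℕ, min l m = s ∧ ∃ G : C.Div0 Ω,
          (G : C.Divisor Ω) ∈ C.rationalDiv Ω n ∧
          HECurve.AffineLE 0 (G : C.Divisor Ω) ∧
          ¬ HECurve.AffineLE (HECurve.Tr n (Dp i : C.Divisor Ω))
              (HECurve.Tr n (G : C.Divisor Ω)) ∧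
          ¬ HECurve.AffineLE (HECurve.Tr n (HECurve.w (Dp i : C.Divisor Ω)))
              (HECurve.Tr n (G : C.Divisor Ω)) ∧
          HECurve.Tr n (D : C.Divisor Ω) =
            m • HECurve.Tr n (Dp i : C.Divisor Ω) +
            l • HECurve.Tr n (HECurve.w (Dp i : C.Divisor Ω)) +
            HECurve.Tr n (G : C.Divisor Ω)) ↔
        (C.func (polyNorm F n (u i) ^ s) 0 ∣
            C.func (h₁.map (algebraMap F L)) (h₂.map (algebraMap F L)) ∧
          ¬ C.func (polyNorm F n (u i) ^ (s + 1)) 0 ∣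
            C.func (h₁.map (algebraMap F L)) (h₂.map (algebraMap F L))))) := by
  have hfin : FiniteDimensional F L :=
    Module.finite_of_finrank_pos (by rw [hL]; exact hn.pos)
  have hLfin : Finite L := Module.finite_of_finite F
  have hΩ : IsAlgClosed Ω := IsAlgClosure.isAlgClosed F
  have hΩa : Algebra.IsAlgebraic F Ω := IsAlgClosure.isAlgebraic
  have hp : ∀ k, HECurve.IsGraphDivisor (Dp k : C.Divisor Ω) (u k) (v k) :=
    fun k => (hprime k).isGraphDivisor
  have hr : ∀ k, (HECurve.φ ^ n) (Dp k : C.Divisor Ω) = Dp k := fun k => (hprime k).2.1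
  subst hsum
  refine ⟨HECurve.dvd_iff_exists_w_eq hn.pos hp hdiv, fun hn2 i => ?_, fun hn2 i hw s => ?_⟩
  · constructor
    · rintro ⟨j, hj, hj0, he⟩
      have hnd : ¬ n ∣ j := Nat.not_dvd_of_pos_of_lt (Nat.pos_of_ne_zero hj0) hj
      obtain ⟨h1, h2⟩ := HECurve.w_eq_self_of_eq_φ_pow hn hn2 hnd (hr i) he
      exact (hprime i).1.two_torsion_of_fixed h1 h2
    · rintro ⟨h1, h2⟩
      obtain ⟨h3, h4⟩ := (hprime i).1.fixed_of_two_torsion h1 h2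
      exact ⟨1, hn.one_lt, one_ne_zero, by rw [pow_one, h3, h4]⟩
  · rw [HECurve.polyNorm_pow_dvd_iff (hp i) hdiv, HECurve.polyNorm_pow_dvd_iff (hp i) hdiv]
    constructor
    · rintro ⟨m, l, rfl, G, -, hG, hG1, hG2, he⟩
      exact HECurve.exact_of_decomposition hn hn2 (hp i) (hr i) hw hG hG1 hG2 he
    · rintro ⟨hs, hs'⟩
      obtain ⟨m, l, G, hGr, hG, hG1, hG2, he⟩ :=
        HECurve.exists_decomposition hn hn2 hp hr i hw
      obtain ⟨k, k'⟩ := HECurve.exact_of_decomposition hn hn2 (hp i) (hr i) hw hG hG1 hG2 he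
      -- Both `min l m` and `s` are exact exponents for the same divisor, hence equal.
      refine ⟨m, l, HECurve.exact_unique (fun P => add_nonneg ?_ ?_) k k' hs hs',
        G, hGr, hG, hG1, hG2, he⟩
      · exact HECurve.Tr_nonneg (hp i).affineLE n P
      · exact HECurve.Tr_nonneg (hp i).w.affineLE n P
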